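/- Let $k$ be a field; algebras are associative, not necessarily unital $k$-algebras. Write $\tilde A=k\oplus A$ for the algebra obtained from $A$ by adjoining a unit; modules over $\tilde A$ are unital right modules. An algebra $R$ is *quasi-free* if every homomorphism $R\to C$ lifts through every surjective homomorphism of algebras $p:B\to C$ with $(\ker p)^2=0$. *Cylinders.* Let $Q^m(R)=R*\dots*R$ be the coproduct of $m+1$ copies of $R$, indexed by $0,\dots,m$, in the category of (nonunital) algebras. Let $q^m(R)$ be the kernel of the map $\mu:Q^m(R)\to R$ which is the identity on every copy of $R$, and put $Cyl^m(R)_n=Q^m(R)/q^m(R)^n$ for $n\ge 0$ (so $Cyl^0(R)_n=R$ for $n\ge 1$, and $Cyl^1(R)_1=R$). For fixed $n$ these form a cosimplicial algebra. Its $i$-th coface map $\partial^i_n:Cyl^m(R)_n\to Cyl^{m+1}(R)_n$ is induced by the order-preserving injection $\{0,\dots,m\}\to\{0,\dots,m+1\}$ omitting $i$. For an algebra map $f:A\to B$ and a right $\tilde A$-module $E$ put $f(E)=E\otimes_{\tilde A}\tilde B$, and likewise for homomorphisms of modules. *Stratifications.* A *stratification* $\theta$ on a right $\tilde R$-module $E$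 is a sequence of isomorphisms $\theta_n:\partial^0_n(E)\to\partial^1_n(E)$ of right modules over $\widetilde{Cyl^1(R)_n}$ ($n\ge 0$, where $\partial^0_n,\partial^1_n:R\to Cyl^1(R)_n$), compatible with the projections $Cyl^1(R)_{n+1}\to Cyl^1(R)_n$, such that $\theta_1$ is the identity of $E$ and $\partial^2_n(\theta_n)\,\partial^0_n(\theta_n)=\partial^1_n(\theta_n)$ for all $n$. A morphism $(E,\theta)\to(E',\theta')$ of stratified modules is an $\tilde R$-module homomorphism $f:E\to E'$ with $\theta'_n\,\partial^0_n(f)=\partial^1_n(f)\,\theta_n$ for all $n$. The *$0$-th coface map* of $(E,\theta)$ at level $n$ is $E\to\partial^0_n(E)\to\partial^1_n(E)$, $e\mapsto\theta_n(e\otimes 1)$. *Flat connections.* Let $\Omega^*(R)$ be the differential graded algebra of noncommutative forms with $\Omega^0(R)=\tilde R$, that is, the unital $k$-algebra generated by symbols $a$ and $da$, linear in $a\in R$, subject to the multiplication of $R$ and $d(ab)=da\,b+a\,db$, graded by the number of $d$'s, with $d(a_0\,da_1\cdots da_n)=da_0\,da_1\cdots da_n$ and $d1=0$. A *connection* on a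 right $\tilde R$-module $E$ is an additive map $\nabla:E\to E\otimes_{\tilde R}\Omega^1(R)$ with $\nabla(es)=\nabla(e)s+e\otimes ds$ for $e\in E$, $s\in\tilde R$. It extends to $E\otimes_{\tilde R}\Omega^*(R)$ by $\nabla(e\otimes\omega)=\nabla(e)\omega+e\otimes d\omega$, and it is *flat* if $\nabla^2=0$ on $E\otimes_{\tilde R}\Omega^*(R)$. A morphism $(E,\nabla)\to(F,D)$ is an $\tilde R$-module homomorphism $\alpha:E\to F$ with $D\alpha=(\alpha\otimes\mathrm{id})\nabla$. There is a decomposition $\widetilde{Cyl^1(R)_2}=\tilde R\oplus\Omega^1(R)$ of left $\tilde R$-modules (through $\partial^1$) under which $\partial^1(a)=a$ and $\partial^0(a)=a+da$ for $a\in R$. It gives $\partial^1_2(E)=E\oplus E\otimes_{\tilde R}\Omega^1(R)$. **Proposition 2.1.** Let $R$ be a quasi-free algebra. For every stratified $\tilde R$-module $(E,\theta)$, the composite $$\nabla:E\to\partial^1_2(E)=E\oplus E\otimes_{\tilde R}\Omega^1(R)\to E\otimes_{\tilde R}\Omega^1(R)$$ of the $0$-th coface map at level $2$ with the projection is a flat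 connection on $E$. If $f:(E,\theta)\to(E',\theta')$ is a morphism of stratified modules, then $f$ is a morphism $(E,\nabla)\to(E',\nabla')$. The functor $(E,\theta)\mapsto(E,\nabla)$, $f\mapsto f$, from the category of stratified $\tilde R$-modules to the category of right $\tilde R$-modules with a flat connection is an isomorphism of categories. -/

import Mathlib

open CategoryTheory MulOpposite
open scoped TensorProduct

universe u v w

set_option linter.unusedSectionVars false

noncomputable section

namespace NCStrat

/-! ### Tensor products over a noncommutative ring

Right `S`-modules are modules over `Sᵐᵒᵖ`; the product `e · s` is written `op s • e`. -/

section BalancedTensor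

variable (S : Type*) [Ring S]
variable (E : Type*) [AddCommGroup E] [Module Sᵐᵒᵖ E]
variable (M : Type*) [AddCommGroup M] [Module S M]

/-- The subgroup of `E ⊗[ℤ] M` generated by all `e · s ⊗ m - e ⊗ s · m`. -/
def balancedRel : AddSubgroup (E ⊗[ℤ] M) :=
  AddSubgroup.closure {x | ∃ (e : E) (s : S) (m : M), x = (op s • e) ⊗ₜ[ℤ] m - e ⊗ₜ[ℤ] (s • m)}

/-- The tensor product `E ⊗_S M` of a right `S`-module `E` and a left `S`-module `M`. -/
def Bal : Type _ := (E ⊗[ℤ] M) ⧸ balancedRel S E M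

instance : AddCommGroup (Bal S E M) :=
  inferInstanceAs (AddCommGroup ((E ⊗[ℤ] M) ⧸ balancedRel S E M))

variable {E M}

/-- The pure tensor `e ⊗ m`. -/
def Bal.tmul (e : E) (m : M) : Bal S E M :=
  QuotientAddGroup.mk' (balancedRel S E M) (e ⊗ₜ[ℤ] m)

theorem Bal.add_tmul (e e' : E) (m : M) :
    Bal.tmul S (e + e') m = Bal.tmul S e m + Bal.tmul S e' m := by
  simp only [Bal.tmul, TensorProduct.add_tmul, map_add]; rfl

theorem Bal.tmul_add (e : E) (m m' : M) :
    Bal.tmul S e (m + m') = Bal.tmul S e m + Bal.tmul S e m' := by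
  simp only [Bal.tmul, TensorProduct.tmul_add, map_add]; rfl

theorem Bal.smul_tmul (e : E) (s : S) (m : M) :
    Bal.tmul S (op s • e) m = Bal.tmul S e (s • m) := by
  unfold Bal.tmul
  refine (QuotientAddGroup.eq_iff_sub_mem).2 ?_
  exact AddSubgroup.subset_closure ⟨e, s, m, rfl⟩

@[elab_as_elim]
theorem Bal.induction_on {P : Bal S E M → Prop} (x : Bal S E M)
    (tmul : ∀ e m, P (Bal.tmul S e m)) (zero : P 0) (add : ∀ x y, P x → P y → P (x + y)) :
    P x := by
  obtain ⟨y, rfl⟩ := QuotientAddGroup.mk'_surjective (balancedRel S E M) x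
  induction y using TensorProduct.induction_on with
  | zero => rw [map_zero]; exact zero
  | tmul e m => exact tmul e m
  | add a b ha hb => rw [map_add]; exact add _ _ ha hb

/-- The map out of `E ⊗_S M` induced by a balanced biadditive map. -/
def Bal.lift {G : Type*} [AddCommGroup G] (φ : E →+ M →+ G)
    (h : ∀ (e : E) (s : S) (m : M), φ (op s • e) m = φ e (s • m)) : Bal S E M →+ G :=
  QuotientAddGroup.lift (balancedRel S E M)
    (TensorProduct.liftAddHom φ (fun r e m => by simp)) (by
      unfold balancedRel
      rw [AddSubgroup.closure_le]
      rintro x ⟨e, s, m, rfl⟩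
      simp [AddMonoidHom.mem_ker, h])

@[simp]
theorem Bal.lift_tmul {G : Type*} [AddCommGroup G] (φ : E →+ M →+ G)
    (h : ∀ (e : E) (s : S) (m : M), φ (op s • e) m = φ e (s • m)) (e : E) (m : M) :
    Bal.lift S φ h (Bal.tmul S e m) = φ e m := rfl

/-- Functoriality: `f ⊗ g : E ⊗_S M → E' ⊗_S M'`. -/
def Bal.map {E' : Type*} [AddCommGroup E'] [Module Sᵐᵒᵖ E'] {M' : Type*} [AddCommGroup M']
    [Module S M'] (f : E →ₗ[Sᵐᵒᵖ] E') (g : M →ₗ[S] M') : Bal S E M →+ Bal S E' M' :=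
  Bal.lift S
    (AddMonoidHom.mk' (fun e => AddMonoidHom.mk' (fun m => Bal.tmul S (f e) (g m))
      (fun m m' => by rw [map_add, Bal.tmul_add]))
      (fun e e' => by ext m; simp [Bal.add_tmul]))
    (fun e s m => by simp [Bal.smul_tmul])

@[simp]
theorem Bal.map_tmul {E' : Type*} [AddCommGroup E'] [Module Sᵐᵒᵖ E'] {M' : Type*}
    [AddCommGroup M'] [Module S M'] (f : E →ₗ[Sᵐᵒᵖ] E') (g : M →ₗ[S] M') (e : E) (m : M) :
    Bal.map S f g (Bal.tmul S e m) = Bal.tmul S (f e) (g m) := rfl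

end BalancedTensor

/-! ### Extension of scalars of right modules along a ring homomorphism -/

section Scalars

variable {S C D : Type*} [Ring S] [Ring C] [Ring D]

/-- The additive group of `C`, regarded as a left `S`-module through `f : S → C`. -/
def Pull (_f : S →+* C) : Type _ := C

instance (f : S →+* C) : AddCommGroup (Pull f) := inferInstanceAs (AddCommGroup C)

/-- The identity map `C → C`, as a map to the left `S`-module `C`. -/
def Pull.of (f : S →+* C) : C ≃+ Pull f := AddEquiv.refl C

instance (f : S →+* C) : Module S (Pull f) where
  smul s x := Pull.of f (f s * (Pull.of f).symm x)
  one_smul x := by change f 1 * (Pull.of f).symm x = _; rw [map_one, one_mul]; rfl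
  mul_smul s t x := by
    change f (s * t) * (Pull.of f).symm x = f s * (f t * (Pull.of f).symm x)
    rw [map_mul, mul_assoc]
  smul_zero s := mul_zero (f s)
  smul_add s x y := mul_add (f s) ((Pull.of f).symm x) ((Pull.of f).symm y)
  add_smul s t x := by
    change f (s + t) * (Pull.of f).symm x = f s * (Pull.of f).symm x + f t * (Pull.of f).symm x
    rw [map_add, add_mul]
  zero_smul x := by change f 0 * (Pull.of f).symm x = 0; rw [map_zero, zero_mul]

theorem Pull.smul_of (f : S →+* C) (s : S) (c : C) : s • Pull.of f c = Pull.of f (f s * c) := rfl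

/-- Right multiplication by `c` on `C`, a map of left `S`-modules. -/
def Pull.mulRight (f : S →+* C) (c : C) : Pull f →ₗ[S] Pull f where
  toFun x := Pull.of f ((Pull.of f).symm x * c)
  map_add' x y := add_mul ((Pull.of f).symm x) ((Pull.of f).symm y) c
  map_smul' s x := mul_assoc (f s) ((Pull.of f).symm x) c

@[simp]
theorem Pull.mulRight_of (f : S →+* C) (c x : C) :
    Pull.mulRight f c (Pull.of f x) = Pull.of f (x * c) := rfl

variable (E : Type*) [AddCommGroup E] [Module Sᵐᵒᵖ E]

/-- `f(E) = E ⊗_S C`, where `C` is a left `S`-module through `f : S → C`. -/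
abbrev ExtScal (f : S →+* C) : Type _ := Bal S E (Pull f)

variable {E}

/-- The pure tensor `e ⊗ c` in `E ⊗_S C`. -/
def ExtScal.tmul (f : S →+* C) (e : E) (c : C) : ExtScal E f := Bal.tmul S e (Pull.of f c)

theorem ExtScal.add_tmul (f : S →+* C) (e e' : E) (c : C) :
    ExtScal.tmul f (e + e') c = ExtScal.tmul f e c + ExtScal.tmul f e' c :=
  Bal.add_tmul S e e' _

theorem ExtScal.tmul_add (f : S →+* C) (e : E) (c c' : C) :
    ExtScal.tmul f e (c + c') = ExtScal.tmul f e c + ExtScal.tmul f e c' := by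
  unfold ExtScal.tmul; rw [map_add, Bal.tmul_add]

theorem ExtScal.op_smul_tmul (f : S →+* C) (e : E) (s : S) (c : C) :
    ExtScal.tmul f (op s • e) c = ExtScal.tmul f e (f s * c) :=
  Bal.smul_tmul S e s _

@[elab_as_elim]
theorem ExtScal.induction_on {f : S →+* C} {P : ExtScal E f → Prop} (x : ExtScal E f)
    (tmul : ∀ e c, P (ExtScal.tmul f e c)) (zero : P 0)
    (add : ∀ x y, P x → P y → P (x + y)) : P x :=
  Bal.induction_on S x (fun e m => tmul e ((Pull.of f).symm m)) zero add

/-- The map out of `E ⊗_S C` induced by a balanced biadditive map. -/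
def ExtScal.lift {G : Type*} [AddCommGroup G] (f : S →+* C) (φ : E →+ C →+ G)
    (h : ∀ (e : E) (s : S) (c : C), φ (op s • e) c = φ e (f s * c)) : ExtScal E f →+ G :=
  Bal.lift S
    (AddMonoidHom.mk' (fun e => (φ e).comp (Pull.of f).symm.toAddMonoidHom)
      (fun e e' => by ext; simp))
    (fun e s m => h e s ((Pull.of f).symm m))

@[simp]
theorem ExtScal.lift_tmul {G : Type*} [AddCommGroup G] (f : S →+* C) (φ : E →+ C →+ G)
    (h : ∀ (e : E) (s : S) (c : C), φ (op s • e) c = φ e (f s * c)) (e : E) (c : C) :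
    ExtScal.lift f φ h (ExtScal.tmul f e c) = φ e c := rfl

/-- Right multiplication by `c` on `E ⊗_S C`. -/
def ExtScal.mulRight (f : S →+* C) (c : C) : ExtScal E f →+ ExtScal E f :=
  Bal.map S LinearMap.id (Pull.mulRight f c)

@[simp]
theorem ExtScal.mulRight_tmul (f : S →+* C) (e : E) (x c : C) :
    ExtScal.mulRight f c (ExtScal.tmul f e x) = ExtScal.tmul f e (x * c) := rfl

/-- The right `C`-module structure of `E ⊗_S C`: `(e ⊗ x) · c = e ⊗ x c`. -/
instance (f : S →+* C) : Module Cᵐᵒᵖ (ExtScal E f) where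
  smul c := ExtScal.mulRight f (unop c)
  one_smul x := by
    change ExtScal.mulRight f 1 x = x
    induction x using ExtScal.induction_on with
    | tmul e m => simp
    | zero => simp
    | add x y hx hy => rw [map_add, hx, hy]
  mul_smul c d x := by
    change ExtScal.mulRight f (unop d * unop c) x =
      ExtScal.mulRight f (unop c) (ExtScal.mulRight f (unop d) x)
    induction x using ExtScal.induction_on with
    | tmul e m => simp [mul_assoc]
    | zero => simp
    | add x y hx hy => simp only [map_add, hx, hy]
  smul_zero c := map_zero (ExtScal.mulRight f (unop c))
  smul_add c := map_add (ExtScal.mulRight f (unop c))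
  add_smul c d x := by
    change ExtScal.mulRight f (unop c + unop d) x =
      ExtScal.mulRight f (unop c) x + ExtScal.mulRight f (unop d) x
    induction x using ExtScal.induction_on with
    | tmul e m => simp [mul_add, ExtScal.tmul_add]
    | zero => simp
    | add x y hx hy => simp only [map_add, hx, hy]; abel
  zero_smul x := by
    change ExtScal.mulRight f 0 x = 0
    induction x using ExtScal.induction_on with
    | tmul e m =>
      have h := ExtScal.tmul_add f e (0 : C) 0
      rw [add_zero] at h
      simpa using h
    | zero => simp
    | add x y hx hy => rw [map_add, hx, hy, add_zero]

@[simp]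
theorem ExtScal.smul_tmul (f : S →+* C) (e : E) (x c : C) :
    op c • ExtScal.tmul f e x = ExtScal.tmul f e (x * c) := rfl

/-- The map `f(E) → f(E')` induced by a homomorphism of right `S`-modules `E → E'`. -/
def ExtScal.mapLeft {E' : Type*} [AddCommGroup E'] [Module Sᵐᵒᵖ E'] (f : S →+* C)
    (α : E →ₗ[Sᵐᵒᵖ] E') : ExtScal E f →+ ExtScal E' f :=
  Bal.map S α LinearMap.id

/-- For `h = g ∘ f`, the map `f(E) → h(E)`, `e ⊗ c ↦ e ⊗ g(c)`. -/
def ExtScal.push (f : S →+* C) (g : C →+* D) (h : S →+* D) (H : g.comp f = h) :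
    ExtScal E f →+ ExtScal E h :=
  ExtScal.lift f
    (AddMonoidHom.mk' (fun e => AddMonoidHom.mk' (fun c => ExtScal.tmul h e (g c))
      (fun c c' => by rw [map_add, ExtScal.tmul_add]))
      (fun e e' => by ext c; simp [ExtScal.add_tmul]))
    (fun e s c => by
      subst H
      simp [ExtScal.op_smul_tmul])

@[simp]
theorem ExtScal.push_tmul (f : S →+* C) (g : C →+* D) (h : S →+* D) (H : g.comp f = h) (e : E)
    (c : C) : ExtScal.push f g h H (ExtScal.tmul f e c) = ExtScal.tmul h e (g c) := rfl

theorem ExtScal.push_smul (f : S →+* C) (g : C →+* D) (h : S →+* D) (H : g.comp f = h)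
    (x : ExtScal E f) (c : C) :
    ExtScal.push f g h H (op c • x) = op (g c) • ExtScal.push f g h H x := by
  induction x using ExtScal.induction_on with
  | tmul e m => simp
  | zero => simp
  | add x y hx hy => simp only [smul_add, map_add, hx, hy]

/-- The additive map underlying `baseChange`. -/
def baseChangeAux {f₀ f₁ : S →+* C} (θ : ExtScal E f₀ →ₗ[Cᵐᵒᵖ] ExtScal E f₁) (g : C →+* D)
    (h₀ h₁ : S →+* D) (H₀ : g.comp f₀ = h₀) (H₁ : g.comp f₁ = h₁) :
    ExtScal E h₀ →+ ExtScal E h₁ :=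
  ExtScal.lift h₀
    (AddMonoidHom.mk' (fun e => AddMonoidHom.mk'
      (fun d : D => ExtScal.mulRight h₁ d (ExtScal.push f₁ g h₁ H₁ (θ (ExtScal.tmul f₀ e 1))))
      (fun d d' => add_smul (op d) (op d') _))
      (fun e e' => by
        ext d
        simp [ExtScal.add_tmul]))
    (fun e s d => by
      have h : θ (ExtScal.tmul f₀ (op s • e) 1) = op (f₀ s) • θ (ExtScal.tmul f₀ e 1) := by
        rw [← map_smul, ExtScal.op_smul_tmul, ExtScal.smul_tmul, mul_one, one_mul]
      have h' : g (f₀ s) = h₀ s := by rw [← H₀]; rfl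
      simp only [AddMonoidHom.mk'_apply]
      rw [h, ExtScal.push_smul, h']
      exact (mul_smul (op d) (op (h₀ s)) _).symm)

theorem baseChangeAux_tmul {f₀ f₁ : S →+* C} (θ : ExtScal E f₀ →ₗ[Cᵐᵒᵖ] ExtScal E f₁)
    (g : C →+* D) (h₀ h₁ : S →+* D) (H₀ : g.comp f₀ = h₀) (H₁ : g.comp f₁ = h₁) (e : E) (d : D) :
    baseChangeAux θ g h₀ h₁ H₀ H₁ (ExtScal.tmul h₀ e d) =
      op d • ExtScal.push f₁ g h₁ H₁ (θ (ExtScal.tmul f₀ e 1)) := by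
  rw [baseChangeAux, ExtScal.lift_tmul]
  rfl

/-- The base change `g(θ)` of a `C`-linear map `θ : f₀(E) → f₁(E)` along `g : C → D`. Under the
identifications `g(fᵢ(E)) = hᵢ(E)`, where `hᵢ = g ∘ fᵢ`, it is the `D`-linear map `h₀(E) → h₁(E)`
with `e ⊗ d ↦ g(θ(e ⊗ 1)) · d`. -/
def baseChange {f₀ f₁ : S →+* C} (θ : ExtScal E f₀ →ₗ[Cᵐᵒᵖ] ExtScal E f₁) (g : C →+* D)
    (h₀ h₁ : S →+* D) (H₀ : g.comp f₀ = h₀) (H₁ : g.comp f₁ = h₁) :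
    ExtScal E h₀ →ₗ[Dᵐᵒᵖ] ExtScal E h₁ where
  toFun := baseChangeAux θ g h₀ h₁ H₀ H₁
  map_add' := map_add _
  map_smul' c x := by
    rw [RingHom.id_apply]
    induction x using ExtScal.induction_on with
    | tmul e d =>
      obtain ⟨c, rfl⟩ := op_surjective c
      rw [ExtScal.smul_tmul, baseChangeAux_tmul, baseChangeAux_tmul, MulOpposite.op_mul, mul_smul]
    | zero => rw [smul_zero, map_zero, smul_zero]
    | add x y hx hy => rw [smul_add, map_add, map_add, hx, hy, smul_add]

theorem baseChange_tmul {f₀ f₁ : S →+* C} (θ : ExtScal E f₀ →ₗ[Cᵐᵒᵖ] ExtScal E f₁) (g : C →+* D)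
    (h₀ h₁ : S →+* D) (H₀ : g.comp f₀ = h₀) (H₁ : g.comp f₁ = h₁) (e : E) (d : D) :
    baseChange θ g h₀ h₁ H₀ H₁ (ExtScal.tmul h₀ e d) =
      op d • ExtScal.push f₁ g h₁ H₁ (θ (ExtScal.tmul f₀ e 1)) :=
  baseChangeAux_tmul θ g h₀ h₁ H₀ H₁ e d

end Scalars

/-! ### Nonunital algebras -/

variable (k : Type u) [Field k]
variable (A : Type v) [NonUnitalRing A] [Module k A] [IsScalarTower k A A] [SMulCommClass k A A]

/-- A (nonunital) `k`-algebra is quasi-free if it has the lifting property for square-zero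
extensions: every homomorphism `A → C` lifts through every surjective homomorphism `p : B → C`
of `k`-algebras with `(ker p)² = 0`. -/
def IsQuasiFree : Prop :=
  ∀ (B C : Type (max u v)) [NonUnitalRing B] [Module k B] [IsScalarTower k B B]
    [SMulCommClass k B B] [NonUnitalRing C] [Module k C] [IsScalarTower k C C]
    [SMulCommClass k C C] (p : B →ₙₐ[k] C), Function.Surjective p →
    (∀ x y : B, p x = 0 → p y = 0 → x * y = 0) →
    ∀ g : A →ₙₐ[k] C, ∃ l : A →ₙₐ[k] B, p.comp l = g

/-- The augmented unital algebra `Ã = k ⊕ A`. -/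
abbrev Tilde : Type (max u v) := Unitization k A

/-! ### The coproduct cosimplicial algebra and the cosimplicial cylinder

Unitization is left adjoint to the forgetful functor from unital to nonunital algebras. So the
unitization of the `(m+1)`-fold coproduct `Q^m(A) = A * ⋯ * A` of nonunital algebras is the unital
free product of `m + 1` copies of `Ã`. -/

/-- The unitization of `Q^m(A)`. -/
def Q (m : ℕ) : Type (max u v) :=
  LinearAlgebra.FreeProduct k (fun _ : Fin (m + 1) => Tilde k A)

instance (m : ℕ) : Ring (Q k A m) :=
  inferInstanceAs (Ring (LinearAlgebra.FreeProduct k (fun _ : Fin (m + 1) => Tilde k A)))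

instance (m : ℕ) : Algebra k (Q k A m) :=
  inferInstanceAs (Algebra k (LinearAlgebra.FreeProduct k (fun _ : Fin (m + 1) => Tilde k A)))

/-- The inclusion of the `i`-th copy of `Ã` in the unitization of `Q^m(A)`. -/
def Q.incl (m : ℕ) (i : Fin (m + 1)) : Tilde k A →ₐ[k] Q k A m :=
  LinearAlgebra.FreeProduct.ι k (fun _ : Fin (m + 1) => Tilde k A) i

/-- The universal property of `Q^m(A)`: a family of homomorphisms of nonunital algebras `A → B`,
indexed by `0, …, m`, gives a homomorphism from `Q^m(A)` to `B`, here written on the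
unitization. -/
def Q.lift {B : Type*} [Ring B] [Algebra k B] (m : ℕ) (f : Fin (m + 1) → A →ₙₐ[k] B) :
    Q k A m →ₐ[k] B :=
  LinearAlgebra.FreeProduct.lift k (fun _ : Fin (m + 1) => Tilde k A)
    (fun {i} => Unitization.lift (f i))

theorem Q.lift_incl {B : Type*} [Ring B] [Algebra k B] (m : ℕ)
    (f : Fin (m + 1) → A →ₙₐ[k] B) (i : Fin (m + 1)) :
    (Q.lift k A m f).comp (Q.incl k A m i) = Unitization.lift (f i) :=
  LinearAlgebra.FreeProduct.lift_comp_ι k (fun _ : Fin (m + 1) => Tilde k A) _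

/-- The `i`-th inclusion restricted to `A`. -/
def Q.inclₙ (m : ℕ) (i : Fin (m + 1)) : A →ₙₐ[k] Q k A m :=
  Unitization.lift.symm (Q.incl k A m i)

/-- The map `Q^m(A) → Q^l(A)` induced by a map of index sets. -/
def Q.map {m l : ℕ} (σ : Fin (m + 1) → Fin (l + 1)) : Q k A m →ₐ[k] Q k A l :=
  Q.lift k A m (fun i => Q.inclₙ k A l (σ i))

/-- The map `μ : Q^m(A) → A` which is the identity on every copy of `A`. -/
def Q.μ (m : ℕ) : Q k A m →ₐ[k] Tilde k A :=
  Q.lift k A m (fun _ => Unitization.inrNonUnitalAlgHom k A)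

/-- The ideal `q^m(A) = ker (μ : Q^m(A) → A)`. It is also the kernel of `μ` on unitizations. -/
def q (m : ℕ) : Ideal (Q k A m) := RingHom.ker (Q.μ k A m)

instance (m : ℕ) : (q k A m).IsTwoSided :=
  inferInstanceAs (RingHom.ker (Q.μ k A m)).IsTwoSided

theorem Q.map_incl {m l : ℕ} (σ : Fin (m + 1) → Fin (l + 1)) (i : Fin (m + 1)) :
    (Q.map k A σ).comp (Q.incl k A m i) = Q.incl k A l (σ i) := by
  rw [Q.map, Q.lift_incl, Q.inclₙ, Equiv.apply_symm_apply]

theorem Q.hom_ext {B : Type*} [Ring B] [Algebra k B] (m : ℕ) {f g : Q k A m →ₐ[k] B}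
    (h : ∀ i, f.comp (Q.incl k A m i) = g.comp (Q.incl k A m i)) : f = g := by
  apply (LinearAlgebra.FreeProduct.lift k (fun _ : Fin (m + 1) => Tilde k A)).symm.injective
  funext i
  exact h i

theorem Q.μ_incl (m : ℕ) (i : Fin (m + 1)) :
    (Q.μ k A m).comp (Q.incl k A m i) = AlgHom.id k _ := by
  rw [Q.μ, Q.lift_incl]
  refine Unitization.lift.symm.injective ?_
  rw [Equiv.symm_apply_apply]
  rfl

theorem Q.μ_map {m l : ℕ} (σ : Fin (m + 1) → Fin (l + 1)) :
    (Q.μ k A l).comp (Q.map k A σ) = Q.μ k A m := by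
  refine Q.hom_ext k A m fun i => ?_
  rw [AlgHom.comp_assoc, Q.map_incl, Q.μ_incl, Q.μ_incl]

theorem Q.map_q_pow {m l : ℕ} (σ : Fin (m + 1) → Fin (l + 1)) (n : ℕ) :
    q k A m ^ n ≤ (q k A l ^ n).comap (Q.map k A σ) := by
  have h1 : q k A m ≤ (q k A l).comap (Q.map k A σ) := fun x hx => by
    have := congrArg (fun f => f x) (Q.μ_map k A σ)
    simp only [AlgHom.comp_apply] at this
    change (Q.μ k A l) (Q.map k A σ x) = 0
    rw [this]; exact hx
  induction n with
  | zero => intro x _; rw [Submodule.pow_zero, Ideal.one_eq_top]; trivial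
  | succ n ih =>
    rw [Submodule.pow_succ, Submodule.pow_succ]
    refine Ideal.mul_le.2 fun a ha b hb => ?_
    rw [Ideal.mem_comap, map_mul]
    exact Ideal.mul_mem_mul (ih ha) (h1 hb)

/-- `Cyl^m(A)_n = Q^m(A) / q^m(A)^n`, after unitization. For `n ≥ 1` this is the unitization of
the nonunital algebra `Q^m(A) / q^m(A)^n`. For `n = 0`, when the nonunital algebra is zero, it is
the zero ring. -/
def Cyl (m n : ℕ) : Type (max u v) := Q k A m ⧸ (q k A m ^ n)

instance (m n : ℕ) : Ring (Cyl k A m n) := inferInstanceAs (Ring (Q k A m ⧸ (q k A m ^ n)))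

/-- The quotient map from the unitization of `Q^m(A)` to `Cyl^m(A)_n`. -/
def Cyl.mk (m n : ℕ) : Q k A m →+* Cyl k A m n := Ideal.Quotient.mk (q k A m ^ n)

/-- The `i`-th copy of `Ã` in `Cyl^m(A)_n`. -/
def Cyl.incl (m n : ℕ) (i : Fin (m + 1)) : Tilde k A →+* Cyl k A m n :=
  (Cyl.mk k A m n).comp (Q.incl k A m i).toRingHom

/-- The cosimplicial structure of `Cyl^*(A)_n`. -/
def Cyl.map (n : ℕ) {m l : ℕ} (σ : Fin (m + 1) → Fin (l + 1)) : Cyl k A m n →+* Cyl k A l n :=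
  Ideal.quotientMap (q k A l ^ n) (Q.map k A σ).toRingHom (Q.map_q_pow k A σ n)

/-- The projection `Cyl^m(A)_{n+1} → Cyl^m(A)_n`. -/
def Cyl.proj (m n : ℕ) : Cyl k A m (n + 1) →+* Cyl k A m n :=
  Ideal.Quotient.factor (Ideal.pow_le_pow_right (Nat.le_succ n))

theorem Cyl.map_incl (n : ℕ) {m l : ℕ} (σ : Fin (m + 1) → Fin (l + 1)) (i : Fin (m + 1)) :
    (Cyl.map k A n σ).comp (Cyl.incl k A m n i) = Cyl.incl k A l n (σ i) := by
  refine RingHom.ext fun a => ?_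
  have := congrArg (fun f => f a) (Q.map_incl k A σ i)
  exact congrArg (Cyl.mk k A l n) this

theorem Cyl.proj_incl (m n : ℕ) (i : Fin (m + 1)) :
    (Cyl.proj k A m n).comp (Cyl.incl k A m (n + 1) i) = Cyl.incl k A m n i := rfl

/-- The coface `∂^j : Cyl^m(A)_n → Cyl^{m+1}(A)_n`, induced by the injection omitting `j`. -/
def Cyl.coface (m n : ℕ) (j : Fin (m + 2)) : Cyl k A m n →+* Cyl k A (m + 1) n :=
  Cyl.map k A n (Fin.succAbove j)

/-- The coface `∂^i : A = Cyl^0(A) → Cyl^1(A)_n` (on unitizations): `∂^0` is the inclusion of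
copy `1` and `∂^1` is the inclusion of copy `0`. -/
def coface₀ (n : ℕ) (i : Fin 2) : Tilde k A →+* Cyl k A 1 n :=
  Cyl.incl k A 1 n (Fin.succAbove i 0)

theorem Cyl.proj_coface₀ (n : ℕ) (i : Fin 2) :
    (Cyl.proj k A 1 n).comp (coface₀ k A (n + 1) i) = coface₀ k A n i :=
  Cyl.proj_incl k A 1 n _

theorem Cyl.coface_coface₀ (n : ℕ) (j : Fin 3) (i : Fin 2) :
    (Cyl.coface k A 1 n j).comp (coface₀ k A n i) =
      Cyl.incl k A 2 n (Fin.succAbove j (Fin.succAbove i 0)) :=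
  Cyl.map_incl k A n (Fin.succAbove j) (Fin.succAbove i 0)

/-! ### Noncommutative differential forms -/

/-- The relations between the generators `a = ι (a, 0)` and `da = ι (0, a)` of the algebra of
noncommutative forms: `a · b = ab` and `d(ab) = da · b + a · db`. -/
inductive Omega.Rel : TensorAlgebra k (A × A) → TensorAlgebra k (A × A) → Prop
  | mul (a b : A) : Omega.Rel
      (TensorAlgebra.ι k (a, (0 : A)) * TensorAlgebra.ι k (b, (0 : A)))
      (TensorAlgebra.ι k (a * b, (0 : A)))
  | leibniz (a b : A) : Omega.Rel
      (TensorAlgebra.ι k ((0 : A), a * b))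
      (TensorAlgebra.ι k ((0 : A), a) * TensorAlgebra.ι k (b, (0 : A)) +
        TensorAlgebra.ι k (a, (0 : A)) * TensorAlgebra.ι k ((0 : A), b))

/-- The algebra of noncommutative differential forms of the nonunital algebra `A`, with a unit
adjoined: the unital `k`-algebra generated by symbols `a` and `da`, linear in `a ∈ A`, subject to
`a · b = ab` and `d(ab) = da · b + a · db`. It is `Ã` in degree `0` and `Ã ⊗ A^{⊗ n}` in degree
`n ≥ 1`, with `a₀ ⊗ a₁ ⊗ ⋯ ⊗ aₙ` corresponding to `a₀ da₁ ⋯ daₙ`. -/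
def Omega : Type (max u v) := RingQuot (Omega.Rel k A)

instance : Ring (Omega k A) := inferInstanceAs (Ring (RingQuot (Omega.Rel k A)))

instance : Algebra k (Omega k A) := inferInstanceAs (Algebra k (RingQuot (Omega.Rel k A)))

/-- The quotient map onto the algebra of forms. -/
def Omega.mk : TensorAlgebra k (A × A) →ₐ[k] Omega k A := RingQuot.mkAlgHom k (Omega.Rel k A)

/-- The map `A → Ω(A)`, `a ↦ a`. -/
def Omega.inA : A →ₙₐ[k] Omega k A where
  toFun a := Omega.mk k A (TensorAlgebra.ι k (a, (0 : A)))
  map_smul' r a := by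
    rw [← map_smul, ← map_smul]; simp
  map_zero' := by
    have : ((0 : A), (0 : A)) = 0 := rfl
    rw [this, map_zero, map_zero]
  map_add' a b := by
    rw [← map_add, ← map_add]; simp
  map_mul' a b := by
    rw [← map_mul]
    exact (RingQuot.mkAlgHom_rel k (Omega.Rel.mul a b)).symm

/-- The map `A → Ω(A)`, `a ↦ da`. -/
def Omega.dA : A →ₗ[k] Omega k A :=
  (Omega.mk k A).toLinearMap ∘ₗ TensorAlgebra.ι k ∘ₗ LinearMap.inr k A A

theorem Omega.dA_mul (a b : A) :
    Omega.dA k A (a * b) =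
      Omega.dA k A a * Omega.inA k A b + Omega.inA k A a * Omega.dA k A b := by
  have h := RingQuot.mkAlgHom_rel k (Omega.Rel.leibniz (k := k) a b)
  rw [map_add, map_mul, map_mul] at h
  exact h

/-- The universal property of the algebra of forms. -/
def Omega.lift {B : Type*} [Ring B] [Algebra k B] (f : A →ₙₐ[k] B) (δ : A →ₗ[k] B)
    (h : ∀ a b, δ (a * b) = δ a * f b + f a * δ b) : Omega k A →ₐ[k] B :=
  RingQuot.liftAlgHom k
    ⟨TensorAlgebra.lift k (LinearMap.coprod (f : A →ₗ[k] B) δ), by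
      intro x y hxy
      cases hxy with
      | mul a b => simp
      | leibniz a b => simp [h]⟩

@[simp]
theorem Omega.lift_inA {B : Type*} [Ring B] [Algebra k B] (f : A →ₙₐ[k] B) (δ : A →ₗ[k] B)
    (h : ∀ a b, δ (a * b) = δ a * f b + f a * δ b) (a : A) :
    Omega.lift k A f δ h (Omega.inA k A a) = f a := by
  refine (RingQuot.liftAlgHom_mkAlgHom_apply k _ _ _).trans ?_
  simp

@[simp]
theorem Omega.lift_dA {B : Type*} [Ring B] [Algebra k B] (f : A →ₙₐ[k] B) (δ : A →ₗ[k] B)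
    (h : ∀ a b, δ (a * b) = δ a * f b + f a * δ b) (a : A) :
    Omega.lift k A f δ h (Omega.dA k A a) = δ a := by
  refine (RingQuot.liftAlgHom_mkAlgHom_apply k _ _ _).trans ?_
  simp

/-- The inclusion of `Ã` in the algebra of forms. -/
def Omega.incl : Tilde k A →ₐ[k] Omega k A := Unitization.lift (Omega.inA k A)

/-- The inclusion of `Ã` in the algebra of forms, as a ring homomorphism. -/
def Omega.inclHom : Tilde k A →+* Omega k A := (Omega.incl k A : Tilde k A →+* Omega k A)

theorem Omega.inclHom_apply (s : Tilde k A) : Omega.inclHom k A s = Omega.incl k A s := rfl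

theorem Omega.incl_inr (a : A) : Omega.incl k A (a : Tilde k A) = Omega.inA k A a := by
  simp [Omega.incl]

/-- The homomorphism `ω ↦ [[(-1)^{|ω|} ω, dω], [0, ω]]`, which encodes the differential `d` and
its Leibniz rule `d(ω η) = dω · η + (-1)^{|ω|} ω · dη`. -/
def Omega.diffHom : Omega k A →ₐ[k] Matrix (Fin 2) (Fin 2) (Omega k A) :=
  Omega.lift k A
    { toFun := fun a => !![Omega.inA k A a, Omega.dA k A a; 0, Omega.inA k A a]
      map_smul' := fun r a => by ext i j; fin_cases i <;> fin_cases j <;> simp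
      map_zero' := by ext i j; fin_cases i <;> fin_cases j <;> simp
      map_add' := fun a b => by ext i j; fin_cases i <;> fin_cases j <;> simp
      map_mul' := fun a b => by
        ext i j
        fin_cases i <;> fin_cases j <;> simp [Omega.dA_mul, Matrix.mul_apply, add_comm] }
    { toFun := fun a => !![-Omega.dA k A a, 0; 0, Omega.dA k A a]
      map_smul' := fun r a => by ext i j; fin_cases i <;> fin_cases j <;> simp
      map_add' := fun a b => by ext i j; fin_cases i <;> fin_cases j <;> simp [add_comm] }
    (fun a b => by
      ext i j
      fin_cases i <;> fin_cases j <;> simp [Omega.dA_mul, add_comm])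

/-- The differential `d` of the algebra of forms:
`d(a₀ da₁ ⋯ daₙ) = da₀ da₁ ⋯ daₙ`, where `d1 = 0`. -/
def Omega.diff : Omega k A →+ Omega k A where
  toFun ω := Omega.diffHom k A ω 0 1
  map_zero' := by simp
  map_add' x y := by simp

/-- The bimodule `Ω^1(A)` of forms of degree `1`, as a left `Ã`-module: the left `Ã`-submodule of
the algebra of forms generated by all `da`. -/
def Omega1 : Submodule (Tilde k A) (Pull (Omega.inclHom k A)) :=
  Submodule.span (Tilde k A) (Set.range fun a => Pull.of (Omega.inclHom k A)
    (Omega.dA k A a))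

theorem Omega1.dA_mem (a : A) :
    Pull.of (Omega.inclHom k A) (Omega.dA k A a) ∈ Omega1 k A :=
  Submodule.subset_span ⟨a, rfl⟩

/-- `Ω^1(A)` is stable under right multiplication by `Ã`. -/
theorem Omega1.mulRight_mem (s : Tilde k A) (x : Pull (Omega.inclHom k A))
    (hx : x ∈ Omega1 k A) :
    Pull.mulRight (Omega.inclHom k A) (Omega.incl k A s) x ∈ Omega1 k A := by
  unfold Omega1 at hx
  induction hx using Submodule.span_induction with
  | zero => rw [map_zero]; exact zero_mem _
  | add x y _ _ hx hy => rw [map_add]; exact add_mem hx hy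
  | smul t x _ hx => rw [map_smul]; exact Submodule.smul_mem _ _ hx
  | mem x hx =>
    obtain ⟨a, rfl⟩ := hx
    have key : Omega.dA k A a * Omega.incl k A s =
        Omega.incl k A (algebraMap k _ s.fst) * Omega.dA k A a + (Omega.dA k A (a * s.snd) -
          Omega.incl k A (a : Tilde k A) * Omega.dA k A s.snd) := by
      have hs : Omega.incl k A s =
          algebraMap k _ s.fst + Omega.inA k A s.snd := by
        simp [Omega.incl]
      rw [hs, Omega.dA_mul, Omega.incl_inr, AlgHom.commutes, mul_add, ← Algebra.commutes]
      abel
    simp only [Pull.mulRight_of]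
    rw [key, map_add, map_sub]
    refine add_mem ?_ (sub_mem (Omega1.dA_mem k A _) ?_)
    · exact Submodule.smul_mem _ (algebraMap k _ s.fst) (Omega1.dA_mem k A a)
    · exact Submodule.smul_mem _ (a : Tilde k A) (Omega1.dA_mem k A s.snd)

/-- Right multiplication by `s ∈ Ã` on `Ω^1(A)`. -/
def Omega1.mulRight (s : Tilde k A) : Omega1 k A →ₗ[Tilde k A] Omega1 k A :=
  (Pull.mulRight (Omega.inclHom k A) (Omega.incl k A s)).restrict
    (Omega1.mulRight_mem k A s)

/-- The multiplication `Ω^1(A) → Ω(A)`, `η ↦ η ω`, by a form `ω`. -/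
def Omega1.mulForm (ω : Omega k A) :
    Omega1 k A →ₗ[Tilde k A] Pull (Omega.inclHom k A) :=
  Pull.mulRight (Omega.inclHom k A) ω ∘ₗ (Omega1 k A).subtype

/-- The derivation `d : Ã → Ω^1(A)`, `λ + a ↦ da`. -/
def Omega1.d : Tilde k A →+ Omega1 k A where
  toFun s := ⟨Pull.of _ (Omega.dA k A s.snd), Omega1.dA_mem k A s.snd⟩
  map_zero' := Subtype.ext (by simp)
  map_add' s t := Subtype.ext (by simp)

theorem Omega.diffHom_inA (a : A) : Omega.diffHom k A (Omega.inA k A a) =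
    !![Omega.inA k A a, Omega.dA k A a; 0, Omega.inA k A a] :=
  Omega.lift_inA k A _ _ _ a

theorem Omega.diffHom_dA (a : A) : Omega.diffHom k A (Omega.dA k A a) =
    !![-Omega.dA k A a, 0; 0, Omega.dA k A a] :=
  Omega.lift_dA k A _ _ _ a

/-- A homomorphism from the algebra of forms sends everything to a subalgebra containing the
images of all `a` and `da`. -/
theorem Omega.mem_of_gen {B : Type*} [Ring B] [Algebra k B] (f : Omega k A →ₐ[k] B)
    (T : Subalgebra k B) (h : ∀ a, f (Omega.inA k A a) ∈ T) (h' : ∀ a, f (Omega.dA k A a) ∈ T)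
    (ω : Omega k A) : f ω ∈ T := by
  obtain ⟨y, rfl⟩ : ∃ y, Omega.mk k A y = ω := RingQuot.mkAlgHom_surjective k _ ω
  have hy : y ∈ Algebra.adjoin k (Set.range (TensorAlgebra.ι k (M := A × A))) := by
    rw [TensorAlgebra.adjoin_range_ι]; trivial
  have hT : Algebra.adjoin k (Set.range (TensorAlgebra.ι k (M := A × A))) ≤
      T.comap (f.comp (Omega.mk k A)) := by
    refine Algebra.adjoin_le ?_
    rintro _ ⟨⟨a, b⟩, rfl⟩
    have e : ((a, b) : A × A) = (a, 0) + (0, b) := by simp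
    rw [e, map_add]
    exact add_mem (h a) (h' b)
  exact hT hy

theorem Omega.diffHom_lower (ω : Omega k A) :
    Omega.diffHom k A ω 1 0 = 0 ∧ Omega.diffHom k A ω 1 1 = ω := by
  let T : Subalgebra k (Matrix (Fin 2) (Fin 2) (Omega k A) × Omega k A) :=
    { carrier := {z | z.1 1 0 = 0 ∧ z.1 1 1 = z.2}
      mul_mem' := by
        rintro ⟨M, x⟩ ⟨N, y⟩ ⟨hM, hM'⟩ ⟨hN, hN'⟩
        simp only at hM hM' hN hN'
        simp [Matrix.mul_apply, hM, hM', hN, hN']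
      add_mem' := by
        rintro ⟨M, x⟩ ⟨N, y⟩ ⟨hM, hM'⟩ ⟨hN, hN'⟩
        simp only at hM hM' hN hN'
        simp [hM, hM', hN, hN']
      algebraMap_mem' := fun r => by simp [Matrix.algebraMap_matrix_apply] }
  refine Omega.mem_of_gen k A ((Omega.diffHom k A).prod (AlgHom.id k _)) T (fun a => ?_)
    (fun a => ?_) ω
  · change Omega.diffHom k A (Omega.inA k A a) 1 0 = 0 ∧
      Omega.diffHom k A (Omega.inA k A a) 1 1 = Omega.inA k A a
    simp [Omega.diffHom_inA]
  · change Omega.diffHom k A (Omega.dA k A a) 1 0 = 0 ∧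
      Omega.diffHom k A (Omega.dA k A a) 1 1 = Omega.dA k A a
    simp [Omega.diffHom_dA]

theorem Omega.diff_incl_mul (s : Tilde k A) (ω : Omega k A) :
    Omega.diff k A (Omega.incl k A s * ω) =
      Omega.dA k A s.snd * ω + Omega.incl k A s * Omega.diff k A ω := by
  have h : Omega.diffHom k A (Omega.incl k A s) =
      !![Omega.incl k A s, Omega.dA k A s.snd; 0, Omega.incl k A s] := by
    have h2 : Omega.incl k A s = algebraMap k _ s.fst + Omega.inA k A s.snd := rfl
    rw [h2, map_add, Omega.diffHom_inA, AlgHom.commutes]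
    ext i j
    fin_cases i <;> fin_cases j <;> simp [Matrix.algebraMap_matrix_apply]
  change Omega.diffHom k A (Omega.incl k A s * ω) 0 1 = _
  rw [map_mul, h, Matrix.mul_apply, Fin.sum_univ_two, (Omega.diffHom_lower k A ω).2]
  simp only [Matrix.of_apply, Matrix.cons_val_zero, Matrix.cons_val_one, Matrix.cons_val',
    Matrix.cons_val_fin_one]
  rw [add_comm]
  rfl

/-! ### The degree-one part of `Cyl^1(A)_2` -/

/-- A homomorphism from `Q^m(A)` sends everything to a subalgebra containing the images of the
copies of `A`. -/
theorem Q.mem_of_gen {B : Type*} [Ring B] [Algebra k B] (m : ℕ) (f : Q k A m →ₐ[k] B)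
    (T : Subalgebra k B) (h : ∀ i s, f (Q.incl k A m i s) ∈ T) (x : Q k A m) : f x ∈ T := by
  let g : Q k A m →ₐ[k] T := LinearAlgebra.FreeProduct.lift k
    (fun _ : Fin (m + 1) => Tilde k A)
    (fun {i} => (f.comp (Q.incl k A m i)).codRestrict T (h i))
  have hg : f = T.val.comp g := by
    refine Q.hom_ext k A m fun i => ?_
    have : g.comp (Q.incl k A m i) = (f.comp (Q.incl k A m i)).codRestrict T (h i) :=
      LinearAlgebra.FreeProduct.lift_comp_ι k (fun _ : Fin (m + 1) => Tilde k A) _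
    rw [AlgHom.comp_assoc, this]
    rfl
  rw [hg]
  exact (g x).2

/-- The homomorphism from copy `i` of `A` to `Ω(A)[ε]`, which is `a ↦ a` for `i = 0` and
`a ↦ a + ε da` for `i = 1`. -/
def taylorGen (i : Fin 2) : A →ₙₐ[k] DualNumber (Omega k A) where
  toFun a := TrivSqZeroExt.inl (Omega.inA k A a) +
    TrivSqZeroExt.inr (if i = 0 then 0 else Omega.dA k A a)
  map_smul' r a := by ext <;> split_ifs <;> simp
  map_zero' := by ext <;> split_ifs <;> simp
  map_add' a b := by ext <;> split_ifs <;> simp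
  map_mul' a b := by ext <;> split_ifs <;> simp [Omega.dA_mul, add_comm]

/-- The homomorphism from `Q^1(A)` to `Ω(A)[ε]` with `a ↦ a` on copy `0` and `a ↦ a + ε da` on
copy `1` of `A`. -/
def Q.taylor : Q k A 1 →ₐ[k] DualNumber (Omega k A) := Q.lift k A 1 (taylorGen k A)

theorem Q.taylor_incl (i : Fin 2) (s : Tilde k A) :
    Q.taylor k A (Q.incl k A 1 i s) = TrivSqZeroExt.inl (Omega.incl k A s) +
      TrivSqZeroExt.inr (if i = 0 then 0 else Omega.dA k A s.snd) := by
  have h := congrArg (fun f => f s) (Q.lift_incl k A 1 (taylorGen k A) i)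
  refine h.trans ?_
  have h1 : Unitization.lift (taylorGen k A i) s =
      TrivSqZeroExt.inl (algebraMap k (Omega k A) s.fst) + taylorGen k A i s.snd := rfl
  have h2 : Omega.incl k A s = algebraMap k (Omega k A) s.fst + Omega.inA k A s.snd := rfl
  rw [h1, h2, TrivSqZeroExt.inl_add, add_assoc]
  rfl

/-- The homomorphism of `Q^1(A)` to `Ω(A)[ε]` reduces to `μ` modulo `ε`, and the coefficient of
`ε` is a form of degree `1`. -/
theorem Q.taylor_mem (x : Q k A 1) :
    (Q.taylor k A x).fst = Omega.incl k A (Q.μ k A 1 x) ∧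
      Pull.of (Omega.inclHom k A) (Q.taylor k A x).snd ∈ Omega1 k A := by
  let T : Subalgebra k (DualNumber (Omega k A) × Tilde k A) :=
    { carrier := {z | z.1.fst = Omega.incl k A z.2 ∧
        Pull.of (Omega.inclHom k A) z.1.snd ∈ Omega1 k A}
      mul_mem' := by
        rintro ⟨x, s⟩ ⟨y, t⟩ ⟨hx, hx'⟩ ⟨hy, hy'⟩
        refine ⟨by simpa using congrArg₂ (· * ·) hx hy, ?_⟩
        simp only at hx hy hx' hy'
        simp only [Prod.mk_mul_mk, TrivSqZeroExt.snd_mul, hx, hy]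
        rw [map_add]
        exact add_mem (Submodule.smul_mem _ s hy') (Omega1.mulRight_mem k A t _ hx')
      add_mem' := by
        rintro ⟨x, s⟩ ⟨y, t⟩ ⟨hx, hx'⟩ ⟨hy, hy'⟩
        refine ⟨by simpa using congrArg₂ (· + ·) hx hy, ?_⟩
        simpa using add_mem hx' hy'
      algebraMap_mem' := fun r => by
        refine ⟨((Omega.incl k A).commutes r).symm, ?_⟩
        change Pull.of (Omega.inclHom k A) 0 ∈ Omega1 k A
        rw [map_zero]
        exact zero_mem _ }
  refine Q.mem_of_gen k A 1 ((Q.taylor k A).prod (Q.μ k A 1)) T (fun i s => ?_) x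
  have hμ : Q.μ k A 1 (Q.incl k A 1 i s) = s := congrArg (fun f => f s) (Q.μ_incl k A 1 i)
  change (Q.taylor k A (Q.incl k A 1 i s)).fst = Omega.incl k A (Q.μ k A 1 (Q.incl k A 1 i s)) ∧
    Pull.of (Omega.inclHom k A) (Q.taylor k A (Q.incl k A 1 i s)).snd ∈ Omega1 k A
  rw [hμ, Q.taylor_incl]
  refine ⟨by rw [TrivSqZeroExt.fst_add, TrivSqZeroExt.fst_inl, TrivSqZeroExt.fst_inr, add_zero],
    ?_⟩
  simp only [TrivSqZeroExt.snd_add, TrivSqZeroExt.snd_inl, TrivSqZeroExt.snd_inr, zero_add]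
  split_ifs
  · rw [map_zero]; exact zero_mem _
  · exact Omega1.dA_mem k A _

theorem Q.taylor_q_sq (x : Q k A 1) (hx : x ∈ q k A 1 ^ 2) : Q.taylor k A x = 0 := by
  have h : ∀ y ∈ q k A 1, (Q.taylor k A y).fst = 0 := fun y hy => by
    rw [(Q.taylor_mem k A y).1, show Q.μ k A 1 y = 0 from hy, map_zero]
  rw [Submodule.pow_succ, Submodule.pow_one] at hx
  refine Submodule.mul_induction_on hx (fun y hy z hz => ?_) (fun y z hy hz => ?_)
  · rw [map_mul]
    ext <;> simp [h y hy, h z hz]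
  · rw [map_add, hy, hz, add_zero]

/-- The homomorphism `Cyl^1(A)_2 → Ω(A)[ε]` with `∂^1(a) ↦ a` and `∂^0(a) ↦ a + ε da`. -/
def Cyl.taylor : Cyl k A 1 2 →+* DualNumber (Omega k A) :=
  Ideal.Quotient.lift (q k A 1 ^ 2) (Q.taylor k A).toRingHom (Q.taylor_q_sq k A)

theorem Cyl.taylor_mk (x : Q k A 1) : Cyl.taylor k A (Cyl.mk k A 1 2 x) = Q.taylor k A x := rfl

theorem Cyl.taylor_coface₀ (i : Fin 2) (s : Tilde k A) :
    Cyl.taylor k A (coface₀ k A 2 i s) = TrivSqZeroExt.inl (Omega.incl k A s) +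
      TrivSqZeroExt.inr (if i = 0 then Omega.dA k A s.snd else 0) := by
  refine (Q.taylor_incl k A (Fin.succAbove i 0) s).trans ?_
  fin_cases i <;> rfl

theorem Cyl.taylor_mem (c : Cyl k A 1 2) :
    Pull.of (Omega.inclHom k A) (Cyl.taylor k A c).snd ∈ Omega1 k A := by
  obtain ⟨x, hx⟩ := Ideal.Quotient.mk_surjective (I := q k A 1 ^ 2) c
  have hx' : Cyl.mk k A 1 2 x = c := hx
  rw [← hx', Cyl.taylor_mk]
  exact (Q.taylor_mem k A x).2

/-- The projection of `Cyl^1(A)_2 = Ã ⊕ Ω^1(A)` (on unitizations) to `Ω^1(A)`, a map of left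
`Ã`-modules through `∂^1`. The decomposition is the one with `∂^1(a) = a` and
`∂^0(a) = a + da`. -/
def Cyl.degOne : Pull (coface₀ k A 2 1) →ₗ[Tilde k A] Omega1 k A where
  toFun c := ⟨Pull.of _ (Cyl.taylor k A ((Pull.of (coface₀ k A 2 1)).symm c)).snd,
    Cyl.taylor_mem k A _⟩
  map_add' c c' := Subtype.ext (by simp)
  map_smul' s c := Subtype.ext (by
    obtain ⟨c, rfl⟩ := (Pull.of (coface₀ k A 2 1)).surjective c
    change Pull.of (Omega.inclHom k A) (Cyl.taylor k A (coface₀ k A 2 1 s * c)).snd =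
      Pull.of (Omega.inclHom k A) (Omega.incl k A s * (Cyl.taylor k A c).snd)
    rw [map_mul, Cyl.taylor_coface₀]
    simp)

theorem Cyl.degOne_coface₀ (i : Fin 2) (s : Tilde k A) :
    Cyl.degOne k A (Pull.of _ (coface₀ k A 2 i s)) = if i = 0 then Omega1.d k A s else 0 := by
  refine Subtype.ext ?_
  change Pull.of (Omega.inclHom k A) (Cyl.taylor k A (coface₀ k A 2 i s)).snd = _
  rw [Cyl.taylor_coface₀]
  split_ifs
  · simp; rfl
  · simp

/-! ### Stratifications -/

section Stratification

variable (E : Type w) [AddCommGroup E] [Module (Tilde k A)ᵐᵒᵖ E]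

/-- `∂^i_n(E) = E ⊗_{∂^i} Cyl^1(A)_n`. -/
abbrev cofaceMod (n : ℕ) (i : Fin 2) : Type _ := ExtScal E (coface₀ k A n i)

variable {E}

/-- The map `∂^j(θ) : ∂^j(∂^0(E)) → ∂^j(∂^1(E))` over `Cyl^2(A)_n`. The composites `∂^j ∂^0` and
`∂^j ∂^1` are the inclusions of the copies `a = δ^j(1)` and `b = δ^j(0)` of `A`, where
`δ^j : [1] → [2]` omits `j`. -/
def cofaceStrat (n : ℕ) (θ : cofaceMod k A E n 0 →ₗ[(Cyl k A 1 n)ᵐᵒᵖ] cofaceMod k A E n 1)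
    (j a b : Fin 3) (ha : Fin.succAbove j (1 : Fin 2) = a) (hb : Fin.succAbove j (0 : Fin 2) = b) :
    ExtScal E (Cyl.incl k A 2 n a) →ₗ[(Cyl k A 2 n)ᵐᵒᵖ] ExtScal E (Cyl.incl k A 2 n b) :=
  baseChange θ (Cyl.coface k A 1 n j) (Cyl.incl k A 2 n a) (Cyl.incl k A 2 n b)
    (by rw [← ha]; exact Cyl.coface_coface₀ k A n j 0)
    (by rw [← hb]; exact Cyl.coface_coface₀ k A n j 1)

variable (E)

/-- A stratification on a right `Ã`-module `E`. -/
@[ext]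
structure Stratification where
  /-- The isomorphisms `θ_n : ∂^0_n(E) ≅ ∂^1_n(E)` of right `Cyl^1(A)_n`-modules. -/
  θ (n : ℕ) : cofaceMod k A E n 0 ≃ₗ[(Cyl k A 1 n)ᵐᵒᵖ] cofaceMod k A E n 1
  /-- `θ_1` is the identity (`∂^0 = ∂^1` is an isomorphism `Ã ≅ Cyl^1(A)_1`). -/
  θ_one (e : E) (c : Cyl k A 1 1) :
    θ 1 (ExtScal.tmul (coface₀ k A 1 0) e c) = ExtScal.tmul (coface₀ k A 1 1) e c
  /-- The `θ_n` are compatible with the projections `Cyl^1(A)_{n+1} → Cyl^1(A)_n`. -/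
  compat (n : ℕ) (x : cofaceMod k A E (n + 1) 0) :
    ExtScal.push (coface₀ k A (n + 1) 1) (Cyl.proj k A 1 n) (coface₀ k A n 1)
        (Cyl.proj_coface₀ k A n 1) (θ (n + 1) x) =
      θ n (ExtScal.push (coface₀ k A (n + 1) 0) (Cyl.proj k A 1 n) (coface₀ k A n 0)
        (Cyl.proj_coface₀ k A n 0) x)
  /-- The cocycle condition `∂^2(θ_n) ∂^0(θ_n) = ∂^1(θ_n)`. -/
  cocycle (n : ℕ) :
    (cofaceStrat k A n (θ n).toLinearMap 2 1 0 (by decide) (by decide)).comp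
        (cofaceStrat k A n (θ n).toLinearMap 0 2 1 (by decide) (by decide)) =
      cofaceStrat k A n (θ n).toLinearMap 1 2 0 (by decide) (by decide)

variable {k A E}

/-- The `0`-th coface map `∂^0_{θ,n} : E → ∂^0_n(E) → ∂^1_n(E)`, `e ↦ θ_n(e ⊗ 1)`. -/
def Stratification.coface0 (s : Stratification k A E) (n : ℕ) : E →+ cofaceMod k A E n 1 :=
  AddMonoidHom.mk' (fun e => s.θ n (ExtScal.tmul (coface₀ k A n 0) e 1)) (fun e e' => by
    rw [← map_add]; exact congrArg _ (ExtScal.add_tmul _ e e' _))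

/-- The degree-one part `∇ : E → ∂^1_2(E) = E ⊕ E ⊗ Ω^1(A) → E ⊗ Ω^1(A)` of the `0`-th coface
map. (The first summand is `E = E ⊗ Ã`.) -/
def Stratification.nabla (s : Stratification k A E) : E →+ Bal (Tilde k A) E (Omega1 k A) :=
  (Bal.map (Tilde k A) LinearMap.id (Cyl.degOne k A)).comp (s.coface0 2)

end Stratification

/-! ### Flat connections -/

section Connection

variable {E : Type w} [AddCommGroup E] [Module (Tilde k A)ᵐᵒᵖ E]

/-- An additive map `∇ : E → E ⊗ Ω^1(A)` is a connection if `∇(e s) = ∇(e) s + e ⊗ ds` for all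
`e ∈ E` and `s ∈ Ã`. For `s ∈ k` this says that `∇` is `k`-linear. -/
def IsConnection (D : E →+ Bal (Tilde k A) E (Omega1 k A)) : Prop :=
  ∀ (e : E) (s : Tilde k A), D (op s • e) =
    Bal.map (Tilde k A) LinearMap.id (Omega1.mulRight k A s) (D e) +
      Bal.tmul (Tilde k A) e (Omega1.d k A s)

variable (E) in
/-- `E ⊗ Ω^*(A)`, where `Ω^0(A)` is `Ã`. -/
abbrev FormsMod : Type _ := ExtScal E (Omega.inclHom k A)

/-- The product `(E ⊗ Ω^1(A)) × Ω^*(A) → E ⊗ Ω^*(A)`. -/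
def mulForm (ω : Omega k A) : Bal (Tilde k A) E (Omega1 k A) →+ FormsMod k A E :=
  Bal.map (Tilde k A) LinearMap.id (Omega1.mulForm k A ω)

theorem mulForm_add (ω η : Omega k A) (x : Bal (Tilde k A) E (Omega1 k A)) :
    mulForm k A (ω + η) x = mulForm k A ω x + mulForm k A η x := by
  induction x using Bal.induction_on with
  | tmul e m =>
    have h : Omega1.mulForm k A (ω + η) m = Omega1.mulForm k A ω m + Omega1.mulForm k A η m :=
      mul_add ((Pull.of (Omega.inclHom k A)).symm m) ω η
    simp only [mulForm, Bal.map_tmul, h, Bal.tmul_add]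
  | zero => simp
  | add x y hx hy => simp only [map_add, hx, hy]; abel

theorem mulForm_mulRight (s : Tilde k A) (ω : Omega k A) (x : Bal (Tilde k A) E (Omega1 k A)) :
    mulForm k A ω (Bal.map (Tilde k A) LinearMap.id (Omega1.mulRight k A s) x) =
      mulForm k A (Omega.incl k A s * ω) x := by
  induction x using Bal.induction_on with
  | tmul e m =>
    have h : Omega1.mulForm k A ω (Omega1.mulRight k A s m) =
        Omega1.mulForm k A (Omega.incl k A s * ω) m :=
      mul_assoc ((Pull.of (Omega.inclHom k A)).symm m) (Omega.incl k A s) ω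
    simp only [mulForm, Bal.map_tmul, h]
    rfl
  | zero => simp
  | add x y hx hy => simp only [map_add, hx, hy]

/-- The extension `∇ : E ⊗ Ω^*(A) → E ⊗ Ω^{*+1}(A)` of a connection,
`∇(e ⊗ ω) = ∇(e) ω + e ⊗ dω`. -/
def IsConnection.extend {D : E →+ Bal (Tilde k A) E (Omega1 k A)} (hD : IsConnection k A D) :
    FormsMod k A E →+ FormsMod k A E :=
  ExtScal.lift (Omega.inclHom k A)
    (AddMonoidHom.mk' (fun e => AddMonoidHom.mk'
      (fun ω => mulForm k A ω (D e) + ExtScal.tmul (Omega.inclHom k A) e (Omega.diff k A ω))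
      (fun ω η => by rw [mulForm_add, map_add, ExtScal.tmul_add]; abel))
      (fun e e' => by
        ext ω
        simp only [AddMonoidHom.mk'_apply, AddMonoidHom.add_apply, map_add, ExtScal.add_tmul]
        abel))
    (fun e s ω => by
      have h : mulForm k A ω (Bal.tmul (Tilde k A) e (Omega1.d k A s)) =
        ExtScal.tmul (Omega.inclHom k A) e (Omega.dA k A s.snd * ω) := rfl
      simp only [AddMonoidHom.mk'_apply]
      rw [hD, map_add, mulForm_mulRight, h, ExtScal.op_smul_tmul, Omega.inclHom_apply,
        Omega.diff_incl_mul, ExtScal.tmul_add, add_assoc])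

theorem IsConnection.extend_tmul {D : E →+ Bal (Tilde k A) E (Omega1 k A)}
    (hD : IsConnection k A D) (e : E) (ω : Omega k A) :
    hD.extend k A (ExtScal.tmul (Omega.inclHom k A) e ω) =
      mulForm k A ω (D e) + ExtScal.tmul (Omega.inclHom k A) e (Omega.diff k A ω) := rfl

/-- A flat connection: a connection whose curvature `∇² : E ⊗ Ω^*(A) → E ⊗ Ω^{*+2}(A)`
vanishes. -/
def IsFlatConnection (D : E →+ Bal (Tilde k A) E (Omega1 k A)) : Prop :=
  ∃ hD : IsConnection k A D, (hD.extend k A).comp (hD.extend k A) = 0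

end Connection

/-! ### The two categories -/

/-- A stratified module: a right `Ã`-module with a stratification. -/
structure StratMod where
  /-- The underlying module. -/
  carrier : Type w
  [grp : AddCommGroup carrier]
  [mod : Module (Tilde k A)ᵐᵒᵖ carrier]
  /-- The stratification. -/
  strat : Stratification k A carrier

attribute [instance] StratMod.grp StratMod.mod

/-- A right `Ã`-module with a flat connection. -/
structure FlatMod where
  /-- The underlying module. -/
  carrier : Type w
  [grp : AddCommGroup carrier]
  [mod : Module (Tilde k A)ᵐᵒᵖ carrier]
  /-- The connection. -/
  conn : carrier →+ Bal (Tilde k A) carrier (Omega1 k A)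
  flat : IsFlatConnection k A conn

attribute [instance] FlatMod.grp FlatMod.mod

variable {k A}

/-- The condition `θ'_n ∂^0_n(f) = ∂^1_n(f) θ_n` for all `n`, on a module homomorphism `f`. -/
def IsStratHom {E E' : Type w} [AddCommGroup E] [Module (Tilde k A)ᵐᵒᵖ E] [AddCommGroup E']
    [Module (Tilde k A)ᵐᵒᵖ E'] (s : Stratification k A E) (s' : Stratification k A E')
    (f : E →ₗ[(Tilde k A)ᵐᵒᵖ] E') : Prop :=
  ∀ (n : ℕ) (x : cofaceMod k A E n 0),
    s'.θ n (ExtScal.mapLeft (coface₀ k A n 0) f x) =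
      ExtScal.mapLeft (coface₀ k A n 1) f (s.θ n x)

/-- The condition `D' f = (f ⊗ id) D` on a module homomorphism `f`. -/
def IsConnHom {E E' : Type w} [AddCommGroup E] [Module (Tilde k A)ᵐᵒᵖ E] [AddCommGroup E']
    [Module (Tilde k A)ᵐᵒᵖ E'] (D : E →+ Bal (Tilde k A) E (Omega1 k A))
    (D' : E' →+ Bal (Tilde k A) E' (Omega1 k A)) (f : E →ₗ[(Tilde k A)ᵐᵒᵖ] E') : Prop :=
  ∀ e : E, D' (f e) = Bal.map (Tilde k A) f LinearMap.id (D e)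

theorem Bal.map_id_right_comp {S : Type*} [Ring S] {E E' E'' M : Type*} [AddCommGroup E]
    [Module Sᵐᵒᵖ E] [AddCommGroup E'] [Module Sᵐᵒᵖ E'] [AddCommGroup E''] [Module Sᵐᵒᵖ E'']
    [AddCommGroup M] [Module S M] (f : E →ₗ[Sᵐᵒᵖ] E') (g : E' →ₗ[Sᵐᵒᵖ] E'') (x : Bal S E M) :
    Bal.map S (g.comp f) (LinearMap.id : M →ₗ[S] M) x =
      Bal.map S g LinearMap.id (Bal.map S f LinearMap.id x) := by
  induction x using Bal.induction_on with
  | tmul e m => rfl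
  | zero => simp
  | add x y hx hy => simp only [map_add, hx, hy]

theorem Bal.map_id_id {S : Type*} [Ring S] {E M : Type*} [AddCommGroup E]
    [Module Sᵐᵒᵖ E] [AddCommGroup M] [Module S M] (x : Bal S E M) :
    Bal.map S (LinearMap.id : E →ₗ[Sᵐᵒᵖ] E) (LinearMap.id : M →ₗ[S] M) x = x := by
  induction x using Bal.induction_on with
  | tmul e m => rfl
  | zero => simp
  | add x y hx hy => simp only [map_add, hx, hy]

/-- A morphism of stratified modules. -/
@[ext]
structure StratMod.Hom (X Y : StratMod.{u, v, w} k A) where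
  /-- The underlying homomorphism of modules. -/
  hom : X.carrier →ₗ[(Tilde k A)ᵐᵒᵖ] Y.carrier
  isStratHom : IsStratHom X.strat Y.strat hom

/-- A morphism of modules with a flat connection. -/
@[ext]
structure FlatMod.Hom (X Y : FlatMod.{u, v, w} k A) where
  /-- The underlying homomorphism of modules. -/
  hom : X.carrier →ₗ[(Tilde k A)ᵐᵒᵖ] Y.carrier
  isConnHom : IsConnHom X.conn Y.conn hom

instance : Category (StratMod.{u, v, w} k A) where
  Hom X Y := StratMod.Hom X Y
  id X := ⟨LinearMap.id, fun n x => by simp only [ExtScal.mapLeft, Bal.map_id_id]⟩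
  comp f g := ⟨g.hom.comp f.hom, fun n x => by
    have hf := f.isStratHom n
    have hg := g.isStratHom n
    simp only [ExtScal.mapLeft] at hf hg
    simp only [ExtScal.mapLeft, Bal.map_id_right_comp, ← hf, ← hg]⟩

instance : Category (FlatMod.{u, v, w} k A) where
  Hom X Y := FlatMod.Hom X Y
  id X := ⟨LinearMap.id, fun e => by rw [Bal.map_id_id]; rfl⟩
  comp f g := ⟨g.hom.comp f.hom, fun e => by
    have hf := f.isConnHom e
    have hg := g.isConnHom (f.hom e)
    rw [Bal.map_id_right_comp, ← hf, ← hg]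
    rfl⟩

/-- The assignment `(E, θ) ↦ (E, ∇)`, `f ↦ f`, as a functor, once it is known that `∇` is a flat
connection and that morphisms of stratified modules are compatible with `∇`. -/
def connFunctor (hflat : ∀ X : StratMod.{u, v, w} k A, IsFlatConnection k A X.strat.nabla)
    (hhom : ∀ (X Y : StratMod.{u, v, w} k A) (f : X ⟶ Y),
      IsConnHom X.strat.nabla Y.strat.nabla f.hom) :
    StratMod.{u, v, w} k A ⥤ FlatMod.{u, v, w} k A where
  obj X := { carrier := X.carrier, conn := X.strat.nabla, flat := hflat X }
  map {X Y} f := ⟨f.hom, hhom X Y f⟩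

/-- An isomorphism of categories: a functor with a strict two-sided inverse. -/
def IsIsoOfCategories {C : Type*} {D : Type*} [Category* C] [Category* D] (F : C ⥤ D) : Prop :=
  ∃ G : D ⥤ C, F ⋙ G = 𝟭 C ∧ G ⋙ F = 𝟭 D

end NCStrat

end

/-!
Let `f = ∂^1` and `g = ∂^0` be the two maps `Ã → Cyl^1(A)_n`. Their difference is a derivation
with values in `Cyl^1(A)_n`, on which `Ã` acts through `f` from the left and through `g` from the
right. So there is a bimodule map `j : Ω^1(A) → Cyl^1(A)_n`, `s da ↦ f(s) (g(a) - f(a))`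
(`oneForm`), and a connection `∇` on `E` gives maps `θ_n(e ⊗ 1) = e ⊗ 1 + j(∇ e)` (`transport`),
which are linear by the Leibniz rule and need no terms of higher degree. All of this makes sense
for any two homomorphisms from `Ã` to a `k`-algebra `C`. For three homomorphisms `f, g, h` the
failure of the cocycle condition is the image of the curvature under `a₀ da₁ da₂ ↦ f(a₀) (g(a₁) -
f(a₁)) (h(a₂) - g(a₂))` (`transportHom_map_oneForm`). A flat connection therefore gives a cocycle,
and its maps are invertible by the cocycle condition for `f, g, f` and `g, f, g`. This is the
stratification `Stratification.ofFlat`.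

Conversely, every stratification has this form (`Stratification.coface0_eq_transport`). There is a
homomorphism from the free product of three copies of `Ã` to triangular `2 × 2` matrices over the
free product of two (`Q.twist`) whose entry above the diagonal kills what comes from the copies
`0` and `1`, is the identity minus the augmentation on what comes from the copies `0` and `2`, and
sees only the part of degree one of what comes from the copies `1` and `2`. Applied to the cocycle
condition, this entry says `θ_n(e ⊗ 1) - e ⊗ 1 = j(∇ e)`. Flatness is then the cocycle condition at
level `3`, because a form of degree two can be recovered from its image in `Cyl^2(A)_3`: a
homomorphism to triangular `3 × 3` matrices over `Ω(A)` detects it (`Q.detect`,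
`map_detectEntry_extend`). Thus `θ` and `∇` determine each other, and the formula for `θ` shows that
they have the same morphisms.
-/

noncomputable section

namespace NCStrat

/-! ### Homomorphisms out of an extension of scalars -/

section Scalars

variable {S C : Type*} [Ring S] [Ring C] {E : Type*} [AddCommGroup E] [Module Sᵐᵒᵖ E]

theorem Bal.tmul_zero {M : Type*} [AddCommGroup M] [Module S M] (e : E) :
    Bal.tmul S e (0 : M) = 0 := by
  have h := Bal.tmul_add S e (0 : M) 0
  rwa [add_zero, left_eq_add] at h

theorem Bal.map_comp {M M' M'' : Type*} [AddCommGroup M] [Module S M] [AddCommGroup M']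
    [Module S M'] [AddCommGroup M''] [Module S M''] (p : M' →ₗ[S] M'') (q : M →ₗ[S] M')
    (x : Bal S E M) :
    Bal.map S LinearMap.id p (Bal.map S (LinearMap.id : E →ₗ[Sᵐᵒᵖ] E) q x) =
      Bal.map S LinearMap.id (p ∘ₗ q) x := by
  induction x using Bal.induction_on with
  | tmul e m => rfl
  | zero => simp
  | add x y hx hy => simp only [map_add, hx, hy]

theorem Bal.map_comm {E' : Type*} [AddCommGroup E'] [Module Sᵐᵒᵖ E'] {M M' : Type*}
    [AddCommGroup M] [Module S M] [AddCommGroup M'] [Module S M'] (α : E →ₗ[Sᵐᵒᵖ] E')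
    (p : M →ₗ[S] M') (x : Bal S E M) :
    Bal.map S LinearMap.id p (Bal.map S α LinearMap.id x) =
      Bal.map S α LinearMap.id (Bal.map S LinearMap.id p x) := by
  induction x using Bal.induction_on with
  | tmul e m => rfl
  | zero => simp
  | add x y hx hy => simp only [map_add, hx, hy]

theorem Bal.map_zero_right {M M' : Type*} [AddCommGroup M] [Module S M] [AddCommGroup M']
    [Module S M'] (x : Bal S E M) :
    Bal.map S (LinearMap.id : E →ₗ[Sᵐᵒᵖ] E) (0 : M →ₗ[S] M') x = 0 := by
  induction x using Bal.induction_on with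
  | tmul e m => simp [Bal.tmul_zero]
  | zero => simp
  | add x y hx hy => simp only [map_add, hx, hy, add_zero]

theorem ExtScal.smul_bal_tmul (f : S →+* C) (e : E) (m : Pull f) (c : C) :
    (op c • (Bal.tmul S e m : ExtScal E f)) = Bal.tmul S e (Pull.mulRight f c m) := rfl

variable {N : Type*} [AddCommGroup N] [Module Cᵐᵒᵖ N]

/-- The `C`-linear map `E ⊗_S C → N`, `e ⊗ c ↦ τ(e) · c`, extending an additive map `τ : E → N`
which is `S`-linear through `f : S → C`. -/
def ExtScal.liftHom (f : S →+* C) (τ : E →+ N) (h : ∀ e s, τ (op s • e) = op (f s) • τ e) :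
    ExtScal E f →ₗ[Cᵐᵒᵖ] N where
  toFun := ExtScal.lift f
    (AddMonoidHom.mk' (fun e => AddMonoidHom.mk' (fun c : C => op c • τ e)
      (fun c c' => by rw [MulOpposite.op_add, add_smul]))
      (fun e e' => by ext c; simp))
    (fun e s c => by simp [h, mul_smul])
  map_add' := map_add _
  map_smul' c x := by
    obtain ⟨c, rfl⟩ := op_surjective c
    induction x using ExtScal.induction_on with
    | tmul e d => simp [mul_smul]
    | zero => simp
    | add x y hx hy => simp only [smul_add, map_add, hx, hy]

@[simp]
theorem ExtScal.liftHom_tmul (f : S →+* C) (τ : E →+ N)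
    (h : ∀ e s, τ (op s • e) = op (f s) • τ e) (e : E) (c : C) :
    ExtScal.liftHom f τ h (ExtScal.tmul f e c) = op c • τ e := rfl

theorem ExtScal.tmul_eq_smul (f : S →+* C) (e : E) (c : C) :
    ExtScal.tmul f e c = op c • ExtScal.tmul f e 1 := by simp

theorem ExtScal.hom_ext {f : S →+* C} {φ ψ : ExtScal E f →ₗ[Cᵐᵒᵖ] N}
    (h : ∀ e, φ (ExtScal.tmul f e 1) = ψ (ExtScal.tmul f e 1)) : φ = ψ := by
  ext x
  induction x using ExtScal.induction_on with
  | tmul e c => rw [ExtScal.tmul_eq_smul, map_smul, map_smul, h]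
  | zero => simp
  | add x y hx hy => simp only [map_add, hx, hy]

theorem ExtScal.map_tmul_smul {f g : S →+* C} (θ : ExtScal E f →ₗ[Cᵐᵒᵖ] ExtScal E g) (e : E)
    (s : S) : θ (ExtScal.tmul f (op s • e) 1) = op (f s) • θ (ExtScal.tmul f e 1) := by
  rw [← map_smul, ExtScal.op_smul_tmul, ExtScal.smul_tmul, mul_one, one_mul]

theorem ExtScal.mapLeft_smul {E' : Type*} [AddCommGroup E'] [Module Sᵐᵒᵖ E'] (f : S →+* C)
    (α : E →ₗ[Sᵐᵒᵖ] E') (c : C) (x : ExtScal E f) :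
    ExtScal.mapLeft f α (op c • x) = op c • ExtScal.mapLeft f α x := by
  induction x using ExtScal.induction_on with
  | tmul e d => rfl
  | zero => simp
  | add x y hx hy => simp only [smul_add, map_add, hx, hy]

end Scalars

/-! ### One-forms as differences of two homomorphisms -/

section Forms

variable {k : Type u} [Field k]
variable {A : Type v} [NonUnitalRing A] [Module k A] [IsScalarTower k A A] [SMulCommClass k A A]
variable {C : Type*} [Ring C] [Algebra k C]

theorem Omega.lift_incl (f : A →ₙₐ[k] C) (δ : A →ₗ[k] C)
    (h : ∀ a b, δ (a * b) = δ a * f b + f a * δ b) (s : Tilde k A) :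
    Omega.lift k A f δ h (Omega.incl k A s) = Unitization.lift f s := by
  have h2 : Omega.incl k A s = algebraMap k (Omega k A) s.fst + Omega.inA k A s.snd := rfl
  rw [h2, map_add, AlgHom.commutes, Omega.lift_inA]
  rfl

/-- The homomorphism `s ↦ diag (f s, g s, h s)`. -/
def diagHom (f g h : Tilde k A →ₐ[k] C) : Tilde k A →ₐ[k] Matrix (Fin 3) (Fin 3) C :=
  (Matrix.diagonalAlgHom k).comp (AlgHom.pi ![f, g, h])

theorem diagHom_apply (f g h : Tilde k A →ₐ[k] C) (s : Tilde k A) :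
    diagHom f g h s = !![f s, 0, 0; 0, g s, 0; 0, 0, h s] := by
  ext i j
  fin_cases i <;> fin_cases j <;> simp [diagHom]

/-- The homomorphism from the algebra of forms to upper triangular matrices with `a ↦
diag (f a, g a, h a)` and `da ↦ (g a - f a) E₀₁ + (h a - g a) E₁₂`. The difference of two
homomorphisms is a derivation with values in the bimodule on which they act from the two sides. -/
def formsHom (f g h : Tilde k A →ₐ[k] C) : Omega k A →ₐ[k] Matrix (Fin 3) (Fin 3) C :=
  Omega.lift k A (Unitization.lift.symm (diagHom f g h))
    { toFun := fun a => !![0, g a - f a, 0; 0, 0, h a - g a; 0, 0, 0]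
      map_smul' := fun r a => by
        ext i j; fin_cases i <;> fin_cases j <;> simp [smul_sub]
      map_add' := fun a b => by
        ext i j; fin_cases i <;> fin_cases j <;> simp <;> abel }
    (fun a b => by
      simp only [Unitization.lift_symm_apply_apply, diagHom_apply]
      ext i j
      fin_cases i <;> fin_cases j <;>
        simp [mul_sub, sub_mul])

variable (f g h : Tilde k A →ₐ[k] C)

theorem formsHom_incl (s : Tilde k A) :
    formsHom f g h (Omega.incl k A s) = !![f s, 0, 0; 0, g s, 0; 0, 0, h s] := by
  rw [formsHom, Omega.lift_incl, Equiv.apply_symm_apply, diagHom_apply]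

theorem formsHom_dA (a : A) : formsHom f g h (Omega.dA k A a) =
    !![0, g a - f a, 0; 0, 0, h a - g a; 0, 0, 0] :=
  Omega.lift_dA k A _ _ _ a

/-- The entry `(0, j)` of `formsHom f g h` is a map of left `Ã`-modules through `f`. -/
def formEntry (j : Fin 3) : Pull (Omega.inclHom k A) →ₗ[Tilde k A] Pull f.toRingHom where
  toFun ω := Pull.of _ (formsHom f g h ((Pull.of _).symm ω) 0 j)
  map_add' ω η := congrArg (fun M : Matrix (Fin 3) (Fin 3) C => M 0 j)
    (map_add (formsHom f g h) ((Pull.of _).symm ω) ((Pull.of _).symm η))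
  map_smul' s ω := by
    obtain ⟨ω, rfl⟩ := (Pull.of _).surjective ω
    rw [Pull.smul_of, RingHom.id_apply, Pull.smul_of]
    congr 1
    simp only [AddEquiv.symm_apply_apply, map_mul, Omega.inclHom_apply, formsHom_incl]
    simp [Matrix.mul_apply, Fin.sum_univ_three]

theorem formEntry_of (j : Fin 3) (ω : Omega k A) :
    formEntry f g h j (Pull.of _ ω) = Pull.of _ (formsHom f g h ω 0 j) := rfl

/-- The map of left `Ã`-modules `Ω^1(A) → C`, `s da ↦ f(s) (g(a) - f(a))`. -/
def oneForm : Omega1 k A →ₗ[Tilde k A] Pull f.toRingHom :=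
  formEntry f g g 1 ∘ₗ (Omega1 k A).subtype

/-- The one-form `da`. -/
def Omega1.gen (a : A) : Omega1 k A := ⟨Pull.of _ (Omega.dA k A a), Omega1.dA_mem k A a⟩

/-- Maps of left `Ã`-modules out of `Ω^1(A)` are determined by their values on the `da`. -/
theorem Omega1.hom_ext {M : Type*} [AddCommGroup M] [Module (Tilde k A) M]
    {p q : Omega1 k A →ₗ[Tilde k A] M} (H : ∀ a : A, p (Omega1.gen a) = q (Omega1.gen a)) :
    p = q := by
  refine LinearMap.ext_on (s := Set.range (Omega1.gen (k := k) (A := A))) ?_ ?_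
  · rw [← Set.image_univ]
    have := Submodule.span_span_coe_preimage (R := Tilde k A)
      (s := Set.range fun a => Pull.of (Omega.inclHom k A) (Omega.dA k A a))
    refine Eq.trans ?_ this
    congr 1
    ext x
    simp only [Set.image_univ, Set.mem_range]
    exact ⟨fun ⟨a, h⟩ => ⟨a, congrArg Subtype.val h⟩, fun ⟨a, h⟩ => ⟨a, Subtype.ext h⟩⟩
  · rintro _ ⟨a, rfl⟩
    exact H a

/-- A property of one-forms that is stable under addition and left multiplication holds if it
holds for all `da`. -/
@[elab_as_elim]
theorem Omega1.induction_on {P : Omega1 k A → Prop} (ω : Omega1 k A) (gen : ∀ a, P (Omega1.gen a))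
    (add : ∀ η ω, P η → P ω → P (η + ω)) (smul : ∀ (s : Tilde k A) ω, P ω → P (s • ω)) : P ω := by
  obtain ⟨ω, hω⟩ := ω
  induction hω using Submodule.span_induction with
  | mem x hx =>
    obtain ⟨a, rfl⟩ := hx
    exact gen a
  | zero =>
    have h := smul 0 (Omega1.gen 0) (gen 0)
    rwa [zero_smul] at h
  | add x y hx hy ihx ihy => exact add ⟨x, hx⟩ ⟨y, hy⟩ ihx ihy
  | smul s x hx ih => exact smul s ⟨x, hx⟩ ih

theorem oneForm_gen (a : A) : oneForm f g (Omega1.gen a) = Pull.of _ (g a - f a) := by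
  change Pull.of _ (formsHom f g g (Omega.dA k A a) 0 1) = _
  rw [formsHom_dA]
  rfl

theorem oneForm_d (s : Tilde k A) : oneForm f g (Omega1.d k A s) = Pull.of _ (g s - f s) := by
  refine (oneForm_gen f g s.snd).trans ?_
  have hs : s = algebraMap k (Tilde k A) s.fst + (s.snd : Tilde k A) :=
    (Unitization.inl_fst_add_inr_snd_eq s).symm
  conv_rhs => rw [hs, map_add, map_add, AlgHom.commutes, AlgHom.commutes, add_sub_add_left_eq_sub]

/-- `oneForm f g` is right linear through `g`. -/
theorem oneForm_mulRight (s : Tilde k A) (ω : Omega1 k A) :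
    oneForm f g (Omega1.mulRight k A s ω) = Pull.mulRight f.toRingHom (g s) (oneForm f g ω) := by
  obtain ⟨ω, hω⟩ := ω
  obtain ⟨ω, rfl⟩ := (Pull.of _).surjective ω
  change Pull.of _ (formsHom f g g (ω * Omega.incl k A s) 0 1) =
    Pull.of _ (formsHom f g g ω 0 1 * g s)
  rw [map_mul, formsHom_incl]
  simp [Matrix.mul_apply, Fin.sum_univ_three]

theorem oneForm_self : oneForm f f = 0 :=
  Omega1.hom_ext fun a => by rw [oneForm_gen, sub_self, map_zero]; rfl

/-- On a one-form, `formsHom f g h` has only the two entries above the diagonal. -/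
theorem formsHom_one (ω : Omega1 k A) :
    formsHom f g h ((Pull.of _).symm ω.1) =
      !![0, (Pull.of _).symm (oneForm f g ω), 0; 0, 0, (Pull.of _).symm (oneForm g h ω);
        0, 0, 0] := by
  induction ω using Omega1.induction_on with
  | gen a =>
    refine (formsHom_dA f g h a).trans ?_
    rw [oneForm_gen, oneForm_gen]
    rfl
  | add x y ihx ihy =>
    refine (map_add (formsHom f g h) ((Pull.of _).symm x.1) ((Pull.of _).symm y.1)).trans ?_
    rw [ihx, ihy, map_add (oneForm f g), map_add (oneForm g h), map_add (Pull.of f.toRingHom).symm,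
      map_add (Pull.of g.toRingHom).symm]
    ext i j; fin_cases i <;> fin_cases j <;> simp
  | smul s x ih =>
    refine (map_mul (formsHom f g h) (Omega.incl k A s) ((Pull.of _).symm x.1)).trans ?_
    rw [ih, formsHom_incl, map_smul (oneForm f g), map_smul (oneForm g h)]
    change _ = !![0, f s * (Pull.of _).symm (oneForm f g x), 0;
      0, 0, g s * (Pull.of _).symm (oneForm g h x); 0, 0, 0]
    ext i j; fin_cases i <;> fin_cases j <;> simp [Matrix.mul_apply, Fin.sum_univ_three]

theorem formsHom_mul_one (η ω : Omega1 k A) :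
    formsHom f g h ((Pull.of _).symm η.1 * (Pull.of _).symm ω.1) 0 2 =
      (Pull.of _).symm (oneForm f g η) * (Pull.of _).symm (oneForm g h ω) := by
  rw [map_mul, formsHom_one, formsHom_one]
  simp [Matrix.mul_apply, Fin.sum_univ_three]

end Forms

/-! ### Parallel transport along a flat connection -/

section Transport

variable {k : Type u} [Field k]
variable {A : Type v} [NonUnitalRing A] [Module k A] [IsScalarTower k A A] [SMulCommClass k A A]
variable {C : Type*} [Ring C] [Algebra k C]
variable {E : Type w} [AddCommGroup E] [Module (Tilde k A)ᵐᵒᵖ E]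
variable (f g h : Tilde k A →ₐ[k] C) {D : E →+ Bal (Tilde k A) E (Omega1 k A)}

theorem map_oneForm_mulRight (s : Tilde k A) (x : Bal (Tilde k A) E (Omega1 k A)) :
    (Bal.map (Tilde k A) LinearMap.id (oneForm f g)
      (Bal.map (Tilde k A) LinearMap.id (Omega1.mulRight k A s) x) : ExtScal E f.toRingHom) =
      op (g s) • (Bal.map (Tilde k A) LinearMap.id (oneForm f g) x : ExtScal E f.toRingHom) := by
  induction x using Bal.induction_on with
  | tmul e ω =>
    simp only [Bal.map_tmul, oneForm_mulRight, ExtScal.smul_bal_tmul, LinearMap.id_apply]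
  | zero => simp only [map_zero, smul_zero]
  | add x y hx hy => simp only [map_add, smul_add, hx, hy]

variable (D) in
/-- The map `E → E ⊗_f C`, `e ↦ e ⊗ 1 + ∇(e)`, where `s da ∈ Ω^1(A)` is read as the element
`f(s) (g(a) - f(a))` of `C`. -/
def transport : E →+ ExtScal E f.toRingHom :=
  AddMonoidHom.mk' (fun e => ExtScal.tmul f.toRingHom e 1 +
    Bal.map (Tilde k A) LinearMap.id (oneForm f g) (D e))
    (fun e e' => by simp only [ExtScal.add_tmul, map_add]; abel)

theorem transport_apply (e : E) : transport f g D e = ExtScal.tmul f.toRingHom e 1 +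
    Bal.map (Tilde k A) LinearMap.id (oneForm f g) (D e) := rfl

theorem transport_smul (hD : IsConnection k A D) (e : E) (s : Tilde k A) :
    transport f g D (op s • e) = op (g.toRingHom s) • transport f g D e := by
  have h1 : (Bal.tmul (Tilde k A) e (Pull.of f.toRingHom (g s - f s)) : ExtScal E f.toRingHom) =
    ExtScal.tmul f.toRingHom e (g s - f s) := rfl
  have h2 : g.toRingHom s = g s := rfl
  have h3 : f.toRingHom s = f s := rfl
  rw [transport_apply, transport_apply, hD, map_add, map_oneForm_mulRight, Bal.map_tmul,
    oneForm_d, LinearMap.id_apply, h1, h2, smul_add, ExtScal.op_smul_tmul, ExtScal.smul_tmul,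
    h3, mul_one, one_mul, add_left_comm, ← ExtScal.tmul_add, add_sub_cancel, add_comm]

/-- The `C`-linear map `E ⊗_g C → E ⊗_f C` with `e ⊗ 1 ↦ e ⊗ 1 + ∇(e)`. -/
def transportHom (hD : IsConnection k A D) :
    ExtScal E g.toRingHom →ₗ[Cᵐᵒᵖ] ExtScal E f.toRingHom :=
  ExtScal.liftHom g.toRingHom (transport f g D) (transport_smul f g hD)

theorem transportHom_tmul (hD : IsConnection k A D) (e : E) (c : C) :
    transportHom f g hD (ExtScal.tmul g.toRingHom e c) = op c • transport f g D e :=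
  ExtScal.liftHom_tmul _ _ _ e c

theorem transportHom_self (hD : IsConnection k A D) :
    transportHom f f hD = LinearMap.id := by
  refine ExtScal.hom_ext fun e => ?_
  rw [transportHom_tmul, op_one, one_smul, transport_apply, oneForm_self, Bal.map_zero_right,
    add_zero, LinearMap.id_apply]

theorem Omega.diff_dA (a : A) : Omega.diff k A (Omega.dA k A a) = 0 := by
  change Omega.diffHom k A (Omega.dA k A a) 0 1 = 0
  rw [Omega.diffHom_dA]
  rfl

theorem Omega.diff_one : Omega.diff k A 1 = 0 := by
  change Omega.diffHom k A 1 0 1 = 0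
  rw [map_one]
  rfl

/-- The failure of `oneForm` to be additive in the pair of homomorphisms is the value of
`formsHom` on the differential, since `g s (h a - g a)` differs from `f s (h a - g a)` by
`(g s - f s) (h a - g a)`. -/
theorem oneForm_add_oneForm (ω : Omega1 k A) :
    (Pull.of _).symm (oneForm f g ω) + (Pull.of _).symm (oneForm g h ω) =
      (Pull.of _).symm (oneForm f h ω) +
        formsHom f g h (Omega.diff k A ((Pull.of _).symm ω.1)) 0 2 := by
  induction ω using Omega1.induction_on with
  | gen a =>
    rw [oneForm_gen, oneForm_gen, oneForm_gen]
    simp only [Omega1.gen, AddEquiv.symm_apply_apply, Omega.diff_dA, map_zero, Matrix.zero_apply]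
    abel
  | add x y ihx ihy =>
    have h0 : Omega.diff k A ((Pull.of _).symm (x + y).1) =
        Omega.diff k A ((Pull.of _).symm x.1) + Omega.diff k A ((Pull.of _).symm y.1) :=
      map_add (Omega.diff k A) ((Pull.of _).symm x.1) ((Pull.of _).symm y.1)
    rw [h0]
    simp only [map_add, Matrix.add_apply]
    rw [add_add_add_comm, ihx, ihy]
    abel
  | smul s x ih =>
    rw [map_smul (oneForm f g), map_smul (oneForm g h), map_smul (oneForm f h)]
    have h1 := formsHom_mul_one f g h (Omega1.d k A s) x
    rw [oneForm_d, AddEquiv.symm_apply_apply] at h1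
    change formsHom f g h (Omega.dA k A s.snd * (Pull.of _).symm x.1) 0 2 = _ at h1
    change f s * (Pull.of _).symm (oneForm f g x) + g s * (Pull.of _).symm (oneForm g h x) =
      f s * (Pull.of _).symm (oneForm f h x) +
        formsHom f g h (Omega.diff k A (Omega.incl k A s * (Pull.of _).symm x.1)) 0 2
    rw [Omega.diff_incl_mul, map_add, Matrix.add_apply, h1, map_mul, formsHom_incl]
    have h2 : (!![f s, 0, 0; 0, g s, 0; 0, 0, h s] *
        formsHom f g h (Omega.diff k A ((Pull.of _).symm x.1))) 0 2 =
        f s * formsHom f g h (Omega.diff k A ((Pull.of _).symm x.1)) 0 2 := by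
      simp [Matrix.mul_apply, Fin.sum_univ_three]
    rw [h2, sub_mul, add_left_comm, ← mul_add, ← ih, mul_add]
    abel

theorem map_formEntry_mulForm (ω : Omega1 k A) (x : Bal (Tilde k A) E (Omega1 k A)) :
    (Bal.map (Tilde k A) LinearMap.id (formEntry f g h 2)
      (mulForm k A ((Pull.of _).symm ω.1) x) : ExtScal E f.toRingHom) =
      op ((Pull.of _).symm (oneForm g h ω)) •
        (Bal.map (Tilde k A) LinearMap.id (oneForm f g) x : ExtScal E f.toRingHom) := by
  induction x using Bal.induction_on with
  | tmul e η =>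
    exact congrArg (fun c => ExtScal.tmul f.toRingHom e c) (formsHom_mul_one f g h η ω)
  | zero => simp only [map_zero, smul_zero]
  | add x y hx hy => simp only [map_add, smul_add, hx, hy]

/-- The failure of the transport maps to compose is the image of `∇² : E → E ⊗ Ω^2(A)` under
`a₀ da₁ da₂ ↦ f(a₀) (g(a₁) - f(a₁)) (h(a₂) - g(a₂))`. -/
theorem transportHom_map_oneForm (hD : IsConnection k A D) (x : Bal (Tilde k A) E (Omega1 k A)) :
    Bal.map (Tilde k A) LinearMap.id (oneForm f g) x +
      transportHom f g hD (Bal.map (Tilde k A) LinearMap.id (oneForm g h) x) =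
    Bal.map (Tilde k A) LinearMap.id (oneForm f h) x +
      Bal.map (Tilde k A) LinearMap.id (formEntry f g h 2)
        (hD.extend k A (mulForm k A 1 x)) := by
  induction x using Bal.induction_on with
  | tmul e ω =>
    have h1 : mulForm k A 1 (Bal.tmul (Tilde k A) e ω) =
        ExtScal.tmul (Omega.inclHom k A) e ((Pull.of _).symm ω.1) :=
      congrArg (ExtScal.tmul (Omega.inclHom k A) e) (mul_one ((Pull.of _).symm ω.1))
    have h2 : transportHom f g hD (Bal.map (Tilde k A) LinearMap.id (oneForm g h)
        (Bal.tmul (Tilde k A) e ω)) =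
        op ((Pull.of _).symm (oneForm g h ω)) • transport f g D e :=
      transportHom_tmul f g hD e _
    have h3 : ∀ j : Omega1 k A →ₗ[Tilde k A] Pull f.toRingHom,
        (Bal.map (Tilde k A) LinearMap.id j (Bal.tmul (Tilde k A) e ω) : ExtScal E f.toRingHom) =
        ExtScal.tmul f.toRingHom e ((Pull.of _).symm (j ω)) := fun _ => rfl
    have h4 : ∀ η, (Bal.map (Tilde k A) LinearMap.id (formEntry f g h 2)
        (ExtScal.tmul (Omega.inclHom k A) e η) : ExtScal E f.toRingHom) =
        ExtScal.tmul f.toRingHom e (formsHom f g h η 0 2) := fun _ => rfl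
    rw [h1, h2, h3, h3, IsConnection.extend_tmul, map_add, map_formEntry_mulForm, h4,
      transport_apply, smul_add, ExtScal.smul_tmul, one_mul, ← add_assoc, ← ExtScal.tmul_add,
      oneForm_add_oneForm, ExtScal.tmul_add]
    abel
  | zero => simp only [map_zero, add_zero]
  | add x y hx hy =>
    simp only [map_add]
    rw [add_add_add_comm, hx, hy]
    abel

theorem IsConnection.extend_tmul_one (hD : IsConnection k A D) (e : E) :
    hD.extend k A (ExtScal.tmul (Omega.inclHom k A) e 1) = mulForm k A 1 (D e) := by
  have h0 : ExtScal.tmul (Omega.inclHom k A) e (0 : Omega k A) = 0 := Bal.tmul_zero e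
  rw [IsConnection.extend_tmul, Omega.diff_one, h0, add_zero]

/-- Transport along a flat connection satisfies the cocycle condition. -/
theorem transportHom_comp (hD : IsConnection k A D)
    (hflat : (hD.extend k A).comp (hD.extend k A) = 0) :
    (transportHom f g hD).comp (transportHom g h hD) = transportHom f h hD := by
  refine ExtScal.hom_ext fun e => ?_
  have h0 : hD.extend k A (mulForm k A 1 (D e)) = 0 := by
    rw [← hD.extend_tmul_one]
    exact DFunLike.congr_fun hflat _
  have h1 := transportHom_map_oneForm f g h hD (D e)
  rw [h0, map_zero, add_zero] at h1
  rw [LinearMap.comp_apply, transportHom_tmul, transportHom_tmul, op_one, one_smul, one_smul,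
    transport_apply, transport_apply, map_add, transportHom_tmul, op_one, one_smul,
    transport_apply, add_assoc, h1]

/-- Transport along a flat connection is invertible, by the cocycle condition for `f, g, f` and
for `g, f, g`. -/
def transportEquiv (hD : IsConnection k A D)
    (hflat : (hD.extend k A).comp (hD.extend k A) = 0) :
    ExtScal E g.toRingHom ≃ₗ[Cᵐᵒᵖ] ExtScal E f.toRingHom :=
  LinearEquiv.ofLinearMap (transportHom f g hD) (transportHom g f hD)
    (by rw [transportHom_comp f g f hD hflat, transportHom_self])
    (by rw [transportHom_comp g f g hD hflat, transportHom_self])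

end Transport

section Naturality

variable {S C C' : Type*} [Ring S] [Ring C] [Ring C']

/-- For `f' = φ ∘ f`, the homomorphism `φ : C → C'` as a map of left `S`-modules. -/
def Pull.push (f : S →+* C) (φ : C →+* C') (f' : S →+* C') (H : φ.comp f = f') :
    Pull f →ₗ[S] Pull f' where
  toFun x := Pull.of f' (φ ((Pull.of f).symm x))
  map_add' x y := map_add φ ((Pull.of f).symm x) ((Pull.of f).symm y)
  map_smul' s x := by
    subst H
    exact map_mul φ (f s) ((Pull.of f).symm x)

theorem Pull.push_of (f : S →+* C) (φ : C →+* C') (f' : S →+* C') (H : φ.comp f = f') (c : C) :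
    Pull.push f φ f' H (Pull.of f c) = Pull.of f' (φ c) := rfl

variable {E : Type*} [AddCommGroup E] [Module Sᵐᵒᵖ E]

theorem ExtScal.push_eq_map (f : S →+* C) (φ : C →+* C') (f' : S →+* C') (H : φ.comp f = f')
    (x : ExtScal E f) :
    ExtScal.push f φ f' H x = Bal.map S LinearMap.id (Pull.push f φ f' H) x := by
  induction x using ExtScal.induction_on with
  | tmul e c => rfl
  | zero => simp
  | add x y hx hy => simp only [map_add, hx, hy]

end Naturality

section TransportNaturality

variable {k : Type u} [Field k]
variable {A : Type v} [NonUnitalRing A] [Module k A] [IsScalarTower k A A] [SMulCommClass k A A]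
variable {C C' : Type*} [Ring C] [Algebra k C] [Ring C'] [Algebra k C']
variable {f g : Tilde k A →ₐ[k] C} {f' g' : Tilde k A →ₐ[k] C'} (φ : C →+* C')
variable (Hf : φ.comp f.toRingHom = f'.toRingHom)

theorem push_comp_oneForm (Hg : φ.comp g.toRingHom = g'.toRingHom) :
    Pull.push f.toRingHom φ f'.toRingHom Hf ∘ₗ oneForm f g = oneForm f' g' := by
  refine Omega1.hom_ext fun a => ?_
  have h1 : φ (f a) = f' a := RingHom.congr_fun Hf _
  have h2 : φ (g a) = g' a := RingHom.congr_fun Hg _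
  rw [LinearMap.comp_apply, oneForm_gen, oneForm_gen, Pull.push_of, map_sub, h1, h2]

variable {E : Type w} [AddCommGroup E] [Module (Tilde k A)ᵐᵒᵖ E]
variable {D : E →+ Bal (Tilde k A) E (Omega1 k A)}

/-- Transport is natural in the algebra. -/
theorem push_transport (Hg : φ.comp g.toRingHom = g'.toRingHom) (e : E) :
    ExtScal.push f.toRingHom φ f'.toRingHom Hf (transport f g D e) = transport f' g' D e := by
  rw [transport_apply, transport_apply, map_add, ExtScal.push_tmul, map_one,
    ExtScal.push_eq_map, Bal.map_comp, push_comp_oneForm φ Hf Hg]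

theorem baseChange_transportHom (Hg : φ.comp g.toRingHom = g'.toRingHom)
    (hD : IsConnection k A D) :
    baseChange (transportHom f g hD) φ g'.toRingHom f'.toRingHom Hg Hf =
      transportHom f' g' hD := by
  refine ExtScal.hom_ext fun e => ?_
  rw [baseChange_tmul, transportHom_tmul, transportHom_tmul, op_one, one_smul, op_one, one_smul,
    one_smul, push_transport φ Hf Hg]

/-- A homomorphism of modules with connections commutes with transport. -/
theorem mapLeft_transport {E' : Type w} [AddCommGroup E'] [Module (Tilde k A)ᵐᵒᵖ E']
    {D' : E' →+ Bal (Tilde k A) E' (Omega1 k A)} {α : E →ₗ[(Tilde k A)ᵐᵒᵖ] E'}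
    (hα : IsConnHom D D' α) (e : E) :
    ExtScal.mapLeft f.toRingHom α (transport f g D e) = transport f g D' (α e) := by
  rw [transport_apply, transport_apply, hα, map_add, Bal.map_comm]
  rfl

end TransportNaturality

/-! ### The stratification of a flat connection -/

section Cylinder

variable (k : Type u) [Field k]
variable (A : Type v) [NonUnitalRing A] [Module k A] [IsScalarTower k A A] [SMulCommClass k A A]

instance (m n : ℕ) : Algebra k (Cyl k A m n) :=
  inferInstanceAs (Algebra k (Q k A m ⧸ (q k A m ^ n)))

/-- `Cyl.incl` as a homomorphism of `k`-algebras. -/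
abbrev Cyl.inclAlg (m n : ℕ) (i : Fin (m + 1)) : Tilde k A →ₐ[k] Cyl k A m n :=
  { Cyl.incl k A m n i with
    commutes' := fun r => congrArg (Cyl.mk k A m n) ((Q.incl k A m i).commutes r) }

/-- `coface₀` as a homomorphism of `k`-algebras. -/
abbrev cofaceAlg (n : ℕ) (i : Fin 2) : Tilde k A →ₐ[k] Cyl k A 1 n :=
  { coface₀ k A n i with
    commutes' := (Cyl.inclAlg k A 1 n (Fin.succAbove i 0)).commutes' }

/-- The two cofaces agree at level `1`, where `Cyl^1(A)_1` is `Ã`. -/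
theorem coface₀_one_eq (s : Tilde k A) : coface₀ k A 1 0 s = coface₀ k A 1 1 s := by
  refine Ideal.Quotient.eq.2 ?_
  rw [Submodule.pow_one]
  have h : ∀ i, Q.μ k A 1 (Q.incl k A 1 i s) = s := fun i =>
    congrArg (fun f => f s) (Q.μ_incl k A 1 i)
  change Q.μ k A 1 (Q.incl k A 1 _ s - Q.incl k A 1 _ s) = 0
  rw [map_sub, h, h, sub_self]

variable {k A}
variable {E : Type w} [AddCommGroup E] [Module (Tilde k A)ᵐᵒᵖ E]
variable {D : E →+ Bal (Tilde k A) E (Omega1 k A)}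

/-- The base change along a coface of transport over `Cyl^1(A)_n` is transport over
`Cyl^2(A)_n`. -/
theorem cofaceStrat_transportHom (hD : IsConnection k A D) (n : ℕ) (j a b : Fin 3)
    (ha : Fin.succAbove j (1 : Fin 2) = a) (hb : Fin.succAbove j (0 : Fin 2) = b) :
    cofaceStrat k A n (transportHom (cofaceAlg k A n 1) (cofaceAlg k A n 0) hD) j a b ha hb =
      transportHom (Cyl.inclAlg k A 2 n b) (Cyl.inclAlg k A 2 n a) hD :=
  baseChange_transportHom (f := cofaceAlg k A n 1) (g := cofaceAlg k A n 0)
    (f' := Cyl.inclAlg k A 2 n b) (g' := Cyl.inclAlg k A 2 n a) (Cyl.coface k A 1 n j)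
    (by subst hb; exact Cyl.coface_coface₀ k A n j 1)
    (by subst ha; exact Cyl.coface_coface₀ k A n j 0) hD

theorem push_proj_transport (n : ℕ) (e : E) :
    ExtScal.push (coface₀ k A (n + 1) 1) (Cyl.proj k A 1 n) (coface₀ k A n 1)
        (Cyl.proj_coface₀ k A n 1) (transport (cofaceAlg k A (n + 1) 1)
          (cofaceAlg k A (n + 1) 0) D e) =
      transport (cofaceAlg k A n 1) (cofaceAlg k A n 0) D e :=
  push_transport (f := cofaceAlg k A (n + 1) 1) (g := cofaceAlg k A (n + 1) 0)
    (f' := cofaceAlg k A n 1) (g' := cofaceAlg k A n 0) (Cyl.proj k A 1 n)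
    (Cyl.proj_coface₀ k A n 1) (Cyl.proj_coface₀ k A n 0) e

/-- The stratification given by transport along a flat connection. -/
def Stratification.ofFlat (hD : IsConnection k A D)
    (hflat : (hD.extend k A).comp (hD.extend k A) = 0) : Stratification k A E where
  θ n := transportEquiv (cofaceAlg k A n 1) (cofaceAlg k A n 0) hD hflat
  θ_one e c := by
    have h0 : oneForm (cofaceAlg k A 1 1) (cofaceAlg k A 1 0) = 0 := by
      refine Omega1.hom_ext fun a => ?_
      rw [oneForm_gen]
      exact sub_eq_zero.2 (coface₀_one_eq k A a)
    refine (transportHom_tmul (cofaceAlg k A 1 1) (cofaceAlg k A 1 0) hD e c).trans ?_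
    rw [transport_apply, h0, Bal.map_zero_right, add_zero, ExtScal.smul_tmul, one_mul]
  compat n x := by
    induction x using ExtScal.induction_on with
    | tmul e c =>
      have h1 := transportHom_tmul (cofaceAlg k A (n + 1) 1) (cofaceAlg k A (n + 1) 0) hD e c
      have h2 := transportHom_tmul (cofaceAlg k A n 1) (cofaceAlg k A n 0) hD e
        (Cyl.proj k A 1 n c)
      refine (congrArg _ h1).trans (Eq.trans ?_ h2.symm)
      rw [ExtScal.push_smul, push_proj_transport]
    | zero => simp only [map_zero]
    | add x y hx hy => simp only [map_add, hx, hy]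
  cocycle n := by
    have h : (transportEquiv (cofaceAlg k A n 1) (cofaceAlg k A n 0) hD hflat).toLinearMap =
      transportHom (cofaceAlg k A n 1) (cofaceAlg k A n 0) hD := rfl
    rw [h, cofaceStrat_transportHom, cofaceStrat_transportHom, cofaceStrat_transportHom]
    exact transportHom_comp _ _ _ hD hflat

theorem Stratification.ofFlat_coface0 (hD : IsConnection k A D)
    (hflat : (hD.extend k A).comp (hD.extend k A) = 0) (n : ℕ) (e : E) :
    (Stratification.ofFlat hD hflat).coface0 n e =
      transport (cofaceAlg k A n 1) (cofaceAlg k A n 0) D e := by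
  refine (transportHom_tmul (cofaceAlg k A n 1) (cofaceAlg k A n 0) hD e 1).trans ?_
  rw [op_one, one_smul]

theorem degOne_comp_oneForm :
    Cyl.degOne k A ∘ₗ oneForm (cofaceAlg k A 2 1) (cofaceAlg k A 2 0) = LinearMap.id := by
  refine Omega1.hom_ext fun a => ?_
  rw [LinearMap.comp_apply, oneForm_gen, map_sub, map_sub]
  refine (congrArg₂ (· - ·) (Cyl.degOne_coface₀ k A 0 a) (Cyl.degOne_coface₀ k A 1 a)).trans ?_
  rw [if_pos rfl, if_neg (by decide), sub_zero]
  rfl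

theorem Stratification.ofFlat_nabla (hD : IsConnection k A D)
    (hflat : (hD.extend k A).comp (hD.extend k A) = 0) :
    (Stratification.ofFlat hD hflat).nabla = D := by
  ext e
  have h1 : Bal.map (Tilde k A) LinearMap.id (Cyl.degOne k A)
      (ExtScal.tmul (coface₀ k A 2 1) e 1) = 0 := by
    refine (congrArg (Bal.tmul (Tilde k A) e) ?_).trans (Bal.tmul_zero e)
    have := Cyl.degOne_coface₀ k A 1 1
    rw [map_one, if_neg (by decide)] at this
    exact this
  change Bal.map (Tilde k A) LinearMap.id (Cyl.degOne k A) (Stratification.coface0 _ 2 e) = _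
  rw [Stratification.ofFlat_coface0, transport_apply, map_add, h1, zero_add, Bal.map_comp,
    degOne_comp_oneForm, Bal.map_id_id]

end Cylinder

/-! ### A representation of three copies by triangular matrices -/

section Twist

variable {k : Type u} [Field k]
variable {A : Type v} [NonUnitalRing A] [Module k A] [IsScalarTower k A A] [SMulCommClass k A A]

/-- The homomorphism `b ↦ [[f b, δ b], [0, g b]]`, for a derivation `δ` with values in the bimodule
on which `f` acts from the left and `g` from the right. -/
def upperHom {B C : Type*} [Ring B] [Algebra k B] [Ring C] [Algebra k C] (f g : B →ₐ[k] C)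
    (δ : B →ₗ[k] C) (h : ∀ a b, δ (a * b) = f a * δ b + δ a * g b) :
    B →ₐ[k] Matrix (Fin 2) (Fin 2) C where
  toFun b := !![f b, δ b; 0, g b]
  map_one' := by
    have h1 := h 1 1
    simp only [mul_one, map_one, one_mul, left_eq_add] at h1
    ext i j; fin_cases i <;> fin_cases j <;> simp [h1]
  map_mul' a b := by
    ext i j; fin_cases i <;> fin_cases j <;> simp [h, Matrix.mul_apply]
  map_zero' := by ext i j; fin_cases i <;> fin_cases j <;> simp
  map_add' a b := by ext i j; fin_cases i <;> fin_cases j <;> simp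
  commutes' r := by
    have h1 := h 1 1
    simp only [mul_one, map_one, one_mul, left_eq_add] at h1
    have h2 : δ (algebraMap k B r) = 0 := by
      rw [Algebra.algebraMap_eq_smul_one, map_smul, h1, smul_zero]
    ext i j; fin_cases i <;> fin_cases j <;> simp [h2, Matrix.algebraMap_matrix_apply]

theorem upperHom_apply {B C : Type*} [Ring B] [Algebra k B] [Ring C] [Algebra k C]
    (f g : B →ₐ[k] C) (δ : B →ₗ[k] C) (h : ∀ a b, δ (a * b) = f a * δ b + δ a * g b) (b : B) :
    upperHom f g δ h b = !![f b, δ b; 0, g b] := rfl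

variable (k A)

/-- The homomorphism from the unitization of `Q^m(A)` given by unital homomorphisms on the
copies of `Ã`. -/
def Q.liftAlg {B : Type*} [Ring B] [Algebra k B] (m : ℕ) (F : Fin (m + 1) → Tilde k A →ₐ[k] B) :
    Q k A m →ₐ[k] B :=
  Q.lift k A m (fun i => Unitization.lift.symm (F i))

theorem Q.liftAlg_incl {B : Type*} [Ring B] [Algebra k B] (m : ℕ)
    (F : Fin (m + 1) → Tilde k A →ₐ[k] B) (i : Fin (m + 1)) (s : Tilde k A) :
    Q.liftAlg k A m F (Q.incl k A m i s) = F i s := by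
  have h := congrArg (fun f => f s) (Q.lift_incl k A m (fun i => Unitization.lift.symm (F i)) i)
  refine h.trans ?_
  rw [Equiv.apply_symm_apply]

/-- The homomorphism `Q^2(A) → M₂(Q^1(A))` with `a ↦ diag (a⁰, a⁰)`, `diag (a⁰, a¹)` and
`[[a⁰, a¹ - a⁰], [0, a¹]]` on the copies `0`, `1` and `2`, where `aⁱ` is `a` in copy `i`.
The entry above the diagonal on copy `2` is a derivation, with copy `0` acting from the left and
copy `1` from the right. -/
def Q.twist : Q k A 2 →ₐ[k] Matrix (Fin 2) (Fin 2) (Q k A 1) :=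
  Q.liftAlg k A 2
    ![upperHom (Q.incl k A 1 0) (Q.incl k A 1 0) 0 (by simp),
      upperHom (Q.incl k A 1 0) (Q.incl k A 1 1) 0 (by simp),
      upperHom (Q.incl k A 1 0) (Q.incl k A 1 1)
        ((Q.incl k A 1 1).toLinearMap - (Q.incl k A 1 0).toLinearMap)
        (by intro a b; simp [mul_sub, sub_mul])]

theorem Q.twist_incl_zero (s : Tilde k A) : Q.twist k A (Q.incl k A 2 0 s) =
    !![Q.incl k A 1 0 s, 0; 0, Q.incl k A 1 0 s] := Q.liftAlg_incl k A 2 _ 0 s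

theorem Q.twist_incl_one (s : Tilde k A) : Q.twist k A (Q.incl k A 2 1 s) =
    !![Q.incl k A 1 0 s, 0; 0, Q.incl k A 1 1 s] := Q.liftAlg_incl k A 2 _ 1 s

theorem Q.twist_incl_two (s : Tilde k A) : Q.twist k A (Q.incl k A 2 2 s) =
    !![Q.incl k A 1 0 s, Q.incl k A 1 1 s - Q.incl k A 1 0 s; 0, Q.incl k A 1 1 s] :=
  Q.liftAlg_incl k A 2 _ 2 s

theorem Q.μ_incl_apply (m : ℕ) (i : Fin (m + 1)) (s : Tilde k A) :
    Q.μ k A m (Q.incl k A m i s) = s := congrArg (fun f => f s) (Q.μ_incl k A m i)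

theorem Q.map_incl_apply {m l : ℕ} (σ : Fin (m + 1) → Fin (l + 1)) (i : Fin (m + 1))
    (s : Tilde k A) : Q.map k A σ (Q.incl k A m i s) = Q.incl k A l (σ i) s :=
  congrArg (fun f => f s) (Q.map_incl k A σ i)

theorem Q.twist_mem (x : Q k A 2) :
    Q.twist k A x 0 0 = Q.incl k A 1 0 (Q.μ k A 2 x) ∧ Q.twist k A x 1 0 = 0 ∧
      Q.twist k A x 0 1 ∈ q k A 1 ∧ Q.μ k A 1 (Q.twist k A x 1 1) = Q.μ k A 2 x := by
  let T : Subalgebra k (Matrix (Fin 2) (Fin 2) (Q k A 1) × Tilde k A) :=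
    { carrier := {z | z.1 0 0 = Q.incl k A 1 0 z.2 ∧ z.1 1 0 = 0 ∧
        Q.μ k A 1 (z.1 0 1) = 0 ∧ Q.μ k A 1 (z.1 1 1) = z.2}
      mul_mem' := by
        rintro ⟨M, s⟩ ⟨N, t⟩ ⟨h1, h2, h3, h4⟩ ⟨h1', h2', h3', h4'⟩
        simp only at h1 h2 h3 h4 h1' h2' h3' h4'
        simp [Matrix.mul_apply, h1, h2, h3, h4, h1', h2', h3', h4']
      add_mem' := by
        rintro ⟨M, s⟩ ⟨N, t⟩ ⟨h1, h2, h3, h4⟩ ⟨h1', h2', h3', h4'⟩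
        simp only at h1 h2 h3 h4 h1' h2' h3' h4'
        simp [h1, h2, h3, h4, h1', h2', h3', h4']
      algebraMap_mem' := fun r => by
        have h1 := (Q.incl k A 1 0).commutes r
        have h2 := (Q.μ k A 1).commutes r
        simp only [Prod.algebraMap_apply, Set.mem_ofPred_eq, Matrix.algebraMap_matrix_apply]
        simp [h1, h2] }
  refine Q.mem_of_gen k A 2 ((Q.twist k A).prod (Q.μ k A 2)) T (fun i s => ?_) x
  change Q.twist k A (Q.incl k A 2 i s) 0 0 = Q.incl k A 1 0 (Q.μ k A 2 (Q.incl k A 2 i s)) ∧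
    Q.twist k A (Q.incl k A 2 i s) 1 0 = 0 ∧ Q.μ k A 1 (Q.twist k A (Q.incl k A 2 i s) 0 1) = 0 ∧
    Q.μ k A 1 (Q.twist k A (Q.incl k A 2 i s) 1 1) = Q.μ k A 2 (Q.incl k A 2 i s)
  rw [Q.μ_incl_apply]
  fin_cases i
  · simp [Q.twist_incl_zero, Q.μ_incl_apply]
  · simp [Q.twist_incl_one, Q.μ_incl_apply]
  · simp [Q.twist_incl_two, Q.μ_incl_apply]

theorem Q.twist_mem_pow (n : ℕ) (x : Q k A 2) (hx : x ∈ q k A 2 ^ (n + 1)) :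
    Q.twist k A x 0 0 = 0 ∧ Q.twist k A x 1 0 = 0 ∧
      Q.twist k A x 0 1 ∈ q k A 1 ^ (n + 1) ∧ Q.twist k A x 1 1 ∈ q k A 1 ^ (n + 1) := by
  have h1 : ∀ y ∈ q k A 2, Q.twist k A y 0 0 = 0 ∧ Q.twist k A y 1 0 = 0 ∧
      Q.twist k A y 0 1 ∈ q k A 1 ∧ Q.twist k A y 1 1 ∈ q k A 1 := fun y hy => by
    have hy' : Q.μ k A 2 y = 0 := hy
    obtain ⟨h1, h2, h3, h4⟩ := Q.twist_mem k A y
    rw [hy'] at h1 h4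
    exact ⟨h1.trans (map_zero _), h2, h3, h4⟩
  induction n generalizing x with
  | zero =>
    rw [zero_add, Submodule.pow_one] at hx ⊢
    exact h1 x hx
  | succ n ih =>
    rw [Submodule.pow_succ] at hx
    rw [Submodule.pow_succ]
    refine Submodule.mul_induction_on hx (fun y hy z hz => ?_) (fun y z hy hz => ?_)
    · obtain ⟨a1, a2, a3, a4⟩ := ih y hy
      obtain ⟨b1, b2, b3, b4⟩ := h1 z hz
      rw [map_mul]
      simp only [Matrix.mul_apply, Fin.sum_univ_two, a1, a2, b1, b2, zero_mul, mul_zero, add_zero,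
        zero_add, true_and]
      exact ⟨Ideal.mul_mem_mul a3 b4, Ideal.mul_mem_mul a4 b4⟩
    · rw [map_add]
      simp only [Matrix.add_apply]
      exact ⟨by rw [hy.1, hz.1, add_zero], by rw [hy.2.1, hz.2.1, add_zero],
        add_mem hy.2.2.1 hz.2.2.1, add_mem hy.2.2.2 hz.2.2.2⟩

/-- On the face of copies `0` and `1`, the matrix of `Q.twist` is diagonal. -/
theorem Q.twist_map_two (x : Q k A 1) : Q.twist k A (Q.map k A (Fin.succAbove (2 : Fin 3)) x) =
    !![Q.incl k A 1 0 (Q.μ k A 1 x), 0; 0, x] := by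
  have h : (Q.twist k A).comp (Q.map k A (m := 1) (l := 2) (Fin.succAbove (2 : Fin 3))) =
      upperHom ((Q.incl k A 1 0).comp (Q.μ k A 1)) (AlgHom.id k _) 0 (by simp) := by
    refine Q.hom_ext k A 1 fun i => AlgHom.ext fun s => ?_
    simp only [AlgHom.comp_apply, Q.map_incl_apply, upperHom_apply, Q.μ_incl_apply]
    fin_cases i
    · exact Q.twist_incl_zero k A s
    · exact Q.twist_incl_one k A s
  exact congrArg (fun f => f x) h

/-- On the face of copies `0` and `2`, the off-diagonal entry of `Q.twist` is the identity minus the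
augmentation: `Q.twist` is there the conjugate of a diagonal matrix by a unipotent one. -/
theorem Q.twist_map_one (x : Q k A 1) : Q.twist k A (Q.map k A (Fin.succAbove (1 : Fin 3)) x) =
    !![Q.incl k A 1 0 (Q.μ k A 1 x), x - Q.incl k A 1 0 (Q.μ k A 1 x); 0, x] := by
  have h : (Q.twist k A).comp (Q.map k A (m := 1) (l := 2) (Fin.succAbove (1 : Fin 3))) =
      upperHom ((Q.incl k A 1 0).comp (Q.μ k A 1)) (AlgHom.id k _)
        (LinearMap.id - ((Q.incl k A 1 0).comp (Q.μ k A 1)).toLinearMap)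
        (by intro a b; simp [mul_sub, sub_mul]) := by
    refine Q.hom_ext k A 1 fun i => AlgHom.ext fun s => ?_
    simp only [AlgHom.comp_apply, Q.map_incl_apply, upperHom_apply, Q.μ_incl_apply]
    fin_cases i
    · refine (Q.twist_incl_zero k A s).trans ?_
      simp [Q.μ_incl_apply]
    · refine (Q.twist_incl_two k A s).trans ?_
      simp [Q.μ_incl_apply]
  exact congrArg (fun f => f x) h

/-- On the face of copies `1` and `2`, the off-diagonal entry of `Q.twist` sees only the part of
degree one, and it sends `a₀ da₁` to `a₀ (a₁¹ - a₁⁰)`. -/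
theorem Q.twist_map_zero (x : Q k A 1) :
    Q.twist k A (Q.map k A (Fin.succAbove (0 : Fin 3)) x) 0 1 =
      formsHom (Q.incl k A 1 0) (Q.incl k A 1 1) (Q.incl k A 1 1) (Q.taylor k A x).snd 0 1 := by
  let f := Q.incl k A 1 0
  let g := Q.incl k A 1 1
  -- The statement is multiplicative only together with the values of the diagonal entries, for
  -- which `Q.twist` on this face has the form `[[f, *], [0, g]]` with `f` and `g` through `μ`.
  let T : Subalgebra k ((Matrix (Fin 2) (Fin 2) (Q k A 1) × DualNumber (Omega k A)) ×
      Tilde k A) :=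
    { carrier := {z | z.1.1 0 0 = f z.2 ∧ z.1.1 1 1 = g z.2 ∧
        z.1.2.fst = Omega.incl k A z.2 ∧ z.1.1 1 0 = 0 ∧
        z.1.1 0 1 = formsHom f g g z.1.2.snd 0 1}
      mul_mem' := by
        rintro ⟨⟨M, x⟩, s⟩ ⟨⟨N, y⟩, t⟩ ⟨h1, h2, h3, h4, h5⟩ ⟨h1', h2', h3', h4', h5'⟩
        simp only at h1 h2 h3 h4 h5 h1' h2' h3' h4' h5'
        refine ⟨?_, ?_, ?_, ?_, ?_⟩
        · simp [Matrix.mul_apply, h1, h1', h4']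
        · simp [Matrix.mul_apply, h2, h2', h4]
        · simp [h3, h3']
        · simp [Matrix.mul_apply, h4, h4']
        · simp only [Prod.mk_mul_mk, TrivSqZeroExt.snd_mul, h3, h3', Matrix.mul_apply,
            Fin.sum_univ_two, h1, h2', h5, h5', smul_eq_mul, MulOpposite.smul_eq_mul_unop,
            MulOpposite.unop_op, map_add, map_mul, formsHom_incl, Matrix.add_apply,
            Fin.sum_univ_three]
          simp
      add_mem' := by
        rintro ⟨⟨M, x⟩, s⟩ ⟨⟨N, y⟩, t⟩ ⟨h1, h2, h3, h4, h5⟩ ⟨h1', h2', h3', h4', h5'⟩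
        simp only at h1 h2 h3 h4 h5 h1' h2' h3' h4' h5'
        refine ⟨?_, ?_, ?_, ?_, ?_⟩
        · simp [h1, h1']
        · simp [h2, h2']
        · simp [h3, h3']
        · simp [h4, h4']
        · simp [h5, h5']
      algebraMap_mem' := fun r => by
        refine ⟨(f.commutes r).symm, (g.commutes r).symm, ((Omega.incl k A).commutes r).symm,
          rfl, ?_⟩
        change (0 : Q k A 1) = formsHom f g g 0 0 1
        rw [map_zero]
        rfl }
  refine (Q.mem_of_gen k A 1 ((((Q.twist k A).comp
    (Q.map k A (m := 1) (l := 2) (Fin.succAbove (0 : Fin 3)))).prod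
      (Q.taylor k A)).prod (Q.μ k A 1)) T (fun i s => ?_) x).2.2.2.2
  change Q.twist k A (Q.map k A _ (Q.incl k A 1 i s)) 0 0 = f (Q.μ k A 1 (Q.incl k A 1 i s)) ∧
    Q.twist k A (Q.map k A _ (Q.incl k A 1 i s)) 1 1 = g (Q.μ k A 1 (Q.incl k A 1 i s)) ∧
    (Q.taylor k A (Q.incl k A 1 i s)).fst = Omega.incl k A (Q.μ k A 1 (Q.incl k A 1 i s)) ∧
    Q.twist k A (Q.map k A _ (Q.incl k A 1 i s)) 1 0 = 0 ∧
    Q.twist k A (Q.map k A _ (Q.incl k A 1 i s)) 0 1 =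
      formsHom f g g (Q.taylor k A (Q.incl k A 1 i s)).snd 0 1
  rw [Q.map_incl_apply, Q.μ_incl_apply, Q.taylor_incl]
  fin_cases i
  · simp only [Fin.zero_eta, Fin.isValue]
    rw [show Fin.succAbove (0 : Fin 3) (0 : Fin 2) = 1 from rfl, Q.twist_incl_one]
    simp [f, g]
  · simp only [Fin.mk_one, Fin.isValue]
    rw [show Fin.succAbove (0 : Fin 3) (1 : Fin 2) = 2 from rfl, Q.twist_incl_two]
    have h := oneForm_d f g s
    change formsHom f g g (Omega.dA k A s.snd) 0 1 = g s - f s at h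
    simp [f, g, h]

end Twist

/-! ### A stratification is determined by its connection -/

section Uniqueness

variable (k : Type u) [Field k]
variable (A : Type v) [NonUnitalRing A] [Module k A] [IsScalarTower k A A] [SMulCommClass k A A]

theorem Cyl.mk_surjective (m n : ℕ) : Function.Surjective (Cyl.mk k A m n) :=
  Ideal.Quotient.mk_surjective

/-- `Q.twist` on the quotients by the positive powers of `q`. -/
def Cyl.twist (n : ℕ) : Cyl k A 2 (n + 1) →+* Matrix (Fin 2) (Fin 2) (Cyl k A 1 (n + 1)) :=
  Ideal.Quotient.lift (q k A 2 ^ (n + 1))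
    ((Cyl.mk k A 1 (n + 1)).mapMatrix.comp (Q.twist k A).toRingHom) (fun x hx => by
      obtain ⟨h1, h2, h3, h4⟩ := Q.twist_mem_pow k A n x hx
      have h3' : Cyl.mk k A 1 (n + 1) (Q.twist k A x 0 1) = 0 := Ideal.Quotient.eq_zero_iff_mem.2 h3
      have h4' : Cyl.mk k A 1 (n + 1) (Q.twist k A x 1 1) = 0 := Ideal.Quotient.eq_zero_iff_mem.2 h4
      ext i j
      change Cyl.mk k A 1 (n + 1) (Q.twist k A x i j) = 0
      fin_cases i <;> fin_cases j
      · exact (congrArg _ h1).trans (map_zero _)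
      · exact h3'
      · exact (congrArg _ h2).trans (map_zero _)
      · exact h4')

theorem Cyl.twist_mk (n : ℕ) (x : Q k A 2) (i j : Fin 2) :
    Cyl.twist k A n (Cyl.mk k A 2 (n + 1) x) i j = Cyl.mk k A 1 (n + 1) (Q.twist k A x i j) := rfl

/-- The augmentation `Cyl^1(A)_{n+1} → Ã` induced by `μ`. There is none at level `0`, where the
ring is zero. -/
def Cyl.aug (n : ℕ) : Cyl k A 1 (n + 1) →+* Tilde k A :=
  Ideal.Quotient.lift (q k A 1 ^ (n + 1)) (Q.μ k A 1).toRingHom (fun x hx => by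
    have h := Ideal.pow_le_pow_right (I := q k A 1) (Nat.succ_pos n) hx
    rw [Submodule.pow_one] at h
    exact h)

theorem Cyl.aug_coface₀ (n : ℕ) (i : Fin 2) (s : Tilde k A) :
    Cyl.aug k A n (coface₀ k A (n + 1) i s) = s := Q.μ_incl_apply k A 1 _ s

theorem Cyl.aug_proj (n : ℕ) (c : Cyl k A 1 (n + 2)) :
    Cyl.aug k A n (Cyl.proj k A 1 (n + 1) c) = Cyl.aug k A (n + 1) c := by
  obtain ⟨x, rfl⟩ := Cyl.mk_surjective k A 1 (n + 2) c
  rfl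

theorem Cyl.coface_mk (m n : ℕ) (j : Fin (m + 2)) (x : Q k A m) :
    Cyl.coface k A m n j (Cyl.mk k A m n x) = Cyl.mk k A (m + 1) n (Q.map k A j.succAbove x) := rfl

theorem Cyl.twist_coface_two (n : ℕ) (c : Cyl k A 1 (n + 1)) :
    Cyl.twist k A n (Cyl.coface k A 1 (n + 1) 2 c) 0 0 =
        coface₀ k A (n + 1) 1 (Cyl.aug k A n c) ∧
      Cyl.twist k A n (Cyl.coface k A 1 (n + 1) 2 c) 0 1 = 0 := by
  obtain ⟨x, rfl⟩ := Cyl.mk_surjective k A 1 (n + 1) c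
  rw [Cyl.coface_mk, Cyl.twist_mk, Cyl.twist_mk, Q.twist_map_two]
  exact ⟨rfl, map_zero _⟩

theorem Cyl.twist_coface_one (n : ℕ) (c : Cyl k A 1 (n + 1)) :
    Cyl.twist k A n (Cyl.coface k A 1 (n + 1) 1 c) 0 1 =
      c - coface₀ k A (n + 1) 1 (Cyl.aug k A n c) := by
  obtain ⟨x, rfl⟩ := Cyl.mk_surjective k A 1 (n + 1) c
  rw [Cyl.coface_mk, Cyl.twist_mk, Q.twist_map_one]
  exact map_sub (Cyl.mk k A 1 (n + 1)) _ _

/-- The projection of `Cyl^1(A)_{n+2}` to `Ω^1(A)`, through `Cyl^1(A)_2 = Ã ⊕ Ω^1(A)`. -/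
def Cyl.degOneAt : (n : ℕ) → Pull (coface₀ k A (n + 2) 1) →ₗ[Tilde k A] Omega1 k A
  | 0 => Cyl.degOne k A
  | n + 1 => Cyl.degOneAt n ∘ₗ Pull.push (coface₀ k A (n + 3) 1) (Cyl.proj k A 1 (n + 2))
      (coface₀ k A (n + 2) 1) (Cyl.proj_coface₀ k A (n + 2) 1)

theorem Cyl.degOneAt_mk (n : ℕ) (x : Q k A 1) :
    (Cyl.degOneAt k A n (Pull.of _ (Cyl.mk k A 1 (n + 2) x))).1 =
      Pull.of _ (Q.taylor k A x).snd := by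
  induction n with
  | zero => rfl
  | succ n ih => exact ih

/-- The entry of `Cyl.twist` above the diagonal, as a map of left `Ã`-modules. -/
def Cyl.twistEntry (n : ℕ) : Pull (Cyl.incl k A 2 (n + 1) 0) →ₗ[Tilde k A]
    Pull (coface₀ k A (n + 1) 1) where
  toFun c := Pull.of _ (Cyl.twist k A n ((Pull.of _).symm c) 0 1)
  map_add' c d := congrArg (fun M : Matrix (Fin 2) (Fin 2) (Cyl k A 1 (n + 1)) => M 0 1)
    (map_add (Cyl.twist k A n) ((Pull.of _).symm c) ((Pull.of _).symm d))
  map_smul' s c := by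
    obtain ⟨c, rfl⟩ := (Pull.of _).surjective c
    have h : ∀ j, Cyl.twist k A n (Cyl.incl k A 2 (n + 1) 0 s) 0 j =
        Cyl.mk k A 1 (n + 1) ((!![Q.incl k A 1 0 s, 0; 0, Q.incl k A 1 0 s] :
          Matrix (Fin 2) (Fin 2) (Q k A 1)) 0 j) := fun j =>
      (Cyl.twist_mk k A n (Q.incl k A 2 0 s) 0 j).trans (by rw [Q.twist_incl_zero])
    have h0 := h 0
    have h1 : Cyl.twist k A n (Cyl.incl k A 2 (n + 1) 0 s) 0 1 = 0 := (h 1).trans (map_zero _)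
    rw [Pull.smul_of, RingHom.id_apply, Pull.smul_of]
    congr 1
    simp only [AddEquiv.symm_apply_apply, map_mul, Matrix.mul_apply, Fin.sum_univ_two]
    rw [h1, zero_mul, add_zero, h0]
    rfl

theorem Cyl.twistEntry_of (n : ℕ) (c : Cyl k A 2 (n + 1)) :
    Cyl.twistEntry k A n (Pull.of _ c) = Pull.of _ (Cyl.twist k A n c 0 1) := rfl

/-- On the face of copies `1` and `2`, the off-diagonal entry of `Cyl.twist` is the part of degree
one. -/
theorem Cyl.twist_coface_zero (n : ℕ) (c : Cyl k A 1 (n + 2)) :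
    Pull.of (coface₀ k A (n + 2) 1) (Cyl.twist k A (n + 1) (Cyl.coface k A 1 (n + 2) 0 c) 0 1) =
      oneForm (cofaceAlg k A (n + 2) 1) (cofaceAlg k A (n + 2) 0)
        (Cyl.degOneAt k A n (Pull.of _ c)) := by
  obtain ⟨x, rfl⟩ := Cyl.mk_surjective k A 1 (n + 2) c
  rw [Cyl.coface_mk, Cyl.twist_mk, Q.twist_map_zero]
  have h := push_comp_oneForm (f := Q.incl k A 1 0) (g := Q.incl k A 1 1)
    (f' := cofaceAlg k A (n + 2) 1) (g' := cofaceAlg k A (n + 2) 0) (Cyl.mk k A 1 (n + 2)) rfl rfl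
  rw [← h]
  have h2 : oneForm (Q.incl k A 1 0) (Q.incl k A 1 1)
      (Cyl.degOneAt k A n (Pull.of _ (Cyl.mk k A 1 (n + 2) x))) =
      formEntry (Q.incl k A 1 0) (Q.incl k A 1 1) (Q.incl k A 1 1) 1
        (Pull.of _ (Q.taylor k A x).snd) := by
    rw [← Cyl.degOneAt_mk k A n x]
    rfl
  rw [LinearMap.comp_apply, h2]
  rfl

variable {k A}
variable {E : Type w} [AddCommGroup E] [Module (Tilde k A)ᵐᵒᵖ E]

variable (k A E) in
/-- The map `∂^1_{n+1}(E) → E` induced by the augmentation. -/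
def augMod (n : ℕ) : cofaceMod k A E (n + 1) 1 →+ E :=
  ExtScal.lift (coface₀ k A (n + 1) 1)
    (AddMonoidHom.mk' (fun e => AddMonoidHom.mk' (fun c => op (Cyl.aug k A n c) • e)
      (fun c c' => by rw [map_add, MulOpposite.op_add, add_smul]))
      (fun e e' => by ext c; simp))
    (fun e s c => by simp [Cyl.aug_coface₀, mul_smul])

theorem augMod_tmul (n : ℕ) (e : E) (c : Cyl k A 1 (n + 1)) :
    augMod k A E n (ExtScal.tmul _ e c) = op (Cyl.aug k A n c) • e := rfl

theorem augMod_push (n : ℕ) (x : cofaceMod k A E (n + 2) 1) :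
    augMod k A E n (ExtScal.push (coface₀ k A (n + 2) 1) (Cyl.proj k A 1 (n + 1))
      (coface₀ k A (n + 1) 1) (Cyl.proj_coface₀ k A (n + 1) 1) x) = augMod k A E (n + 1) x := by
  induction x using ExtScal.induction_on with
  | tmul e c =>
    rw [ExtScal.push_tmul, augMod_tmul, augMod_tmul, Cyl.aug_proj]
  | zero => simp only [map_zero]
  | add x y hx hy => simp only [map_add, hx, hy]

variable (s : Stratification k A E)

theorem Stratification.coface0_apply (n : ℕ) (e : E) :
    s.coface0 n e = s.θ n (ExtScal.tmul (coface₀ k A n 0) e 1) := rfl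

theorem Stratification.push_coface0 (n : ℕ) (e : E) :
    ExtScal.push (coface₀ k A (n + 1) 1) (Cyl.proj k A 1 n) (coface₀ k A n 1)
        (Cyl.proj_coface₀ k A n 1) (s.coface0 (n + 1) e) = s.coface0 n e := by
  rw [Stratification.coface0_apply, s.compat, ExtScal.push_tmul, map_one]
  rfl

/-- A stratification is the identity modulo `q`. -/
theorem Stratification.augMod_coface0 (n : ℕ) (e : E) :
    augMod k A E n (s.coface0 (n + 1) e) = e := by
  induction n with
  | zero => rw [Stratification.coface0_apply, s.θ_one, augMod_tmul, map_one, op_one, one_smul]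
  | succ n ih => rw [← augMod_push, s.push_coface0, ih]

theorem Stratification.map_degOneAt_coface0 (n : ℕ) (e : E) :
    Bal.map (Tilde k A) LinearMap.id (Cyl.degOneAt k A n) (s.coface0 (n + 2) e) = s.nabla e := by
  induction n with
  | zero => rfl
  | succ n ih =>
    rw [← ih, ← s.push_coface0 (n + 2), ExtScal.push_eq_map, Bal.map_comp]
    rfl

/-- The twisted entry kills everything of the face of copies `0` and `1` but its augmentation. -/
theorem map_twistEntry_smul_push (n : ℕ)
    (H : (Cyl.coface k A 1 (n + 2) 2).comp (coface₀ k A (n + 2) 1) = Cyl.incl k A 2 (n + 2) 0)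
    (y : cofaceMod k A E (n + 2) 1) (c : Cyl k A 1 (n + 2)) :
    Bal.map (Tilde k A) LinearMap.id (Cyl.twistEntry k A (n + 1))
      (op (Cyl.coface k A 1 (n + 2) 0 c) • ExtScal.push (coface₀ k A (n + 2) 1)
        (Cyl.coface k A 1 (n + 2) 2) (Cyl.incl k A 2 (n + 2) 0) H y) =
      Bal.tmul (Tilde k A) (augMod k A E (n + 1) y)
        (oneForm (cofaceAlg k A (n + 2) 1) (cofaceAlg k A (n + 2) 0)
          (Cyl.degOneAt k A n (Pull.of _ c))) := by
  induction y using ExtScal.induction_on with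
  | tmul e d =>
    obtain ⟨h1, h2⟩ := Cyl.twist_coface_two k A (n + 1) d
    have h3 : Cyl.twistEntry k A (n + 1) (Pull.of _
        (Cyl.coface k A 1 (n + 2) 2 d * Cyl.coface k A 1 (n + 2) 0 c)) =
        Cyl.aug k A (n + 1) d • Pull.of (coface₀ k A (n + 2) 1)
          (Cyl.twist k A (n + 1) (Cyl.coface k A 1 (n + 2) 0 c) 0 1) := by
      rw [Cyl.twistEntry_of, map_mul, Matrix.mul_apply, Fin.sum_univ_two, h1, h2, zero_mul,
        add_zero, Pull.smul_of]
    rw [ExtScal.push_tmul, ExtScal.smul_tmul, augMod_tmul, Bal.smul_tmul, ← Cyl.twist_coface_zero,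
      ← h3]
    rfl
  | zero =>
    have h0 : ∀ m : Pull (coface₀ k A (n + 2) 1), Bal.tmul (Tilde k A) (0 : E) m = 0 := fun m => by
      have h := Bal.add_tmul (Tilde k A) (0 : E) 0 m
      rwa [add_zero, left_eq_add] at h
    rw [map_zero, smul_zero, map_zero, map_zero]
    exact (h0 _).symm
  | add x y hx hy =>
    rw [map_add, smul_add, map_add, hx, hy, map_add]
    exact (Bal.add_tmul _ _ _ _).symm

/-- On the face of copies `0` and `2`, the twisted entry is the identity minus the augmentation. -/
theorem map_twistEntry_push_one (n : ℕ)
    (H : (Cyl.coface k A 1 (n + 1) 1).comp (coface₀ k A (n + 1) 1) = Cyl.incl k A 2 (n + 1) 0)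
    (y : cofaceMod k A E (n + 1) 1) :
    Bal.map (Tilde k A) LinearMap.id (Cyl.twistEntry k A n)
      (ExtScal.push (coface₀ k A (n + 1) 1) (Cyl.coface k A 1 (n + 1) 1)
        (Cyl.incl k A 2 (n + 1) 0) H y) =
      y - ExtScal.tmul (coface₀ k A (n + 1) 1) (augMod k A E n y) 1 := by
  induction y using ExtScal.induction_on with
  | tmul e d =>
    rw [augMod_tmul, ExtScal.op_smul_tmul, mul_one, ExtScal.push_tmul, eq_sub_iff_add_eq]
    refine Eq.trans ?_ (congrArg (ExtScal.tmul (coface₀ k A (n + 1) 1) e)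
      (sub_add_cancel d (coface₀ k A (n + 1) 1 (Cyl.aug k A n d))))
    rw [ExtScal.tmul_add, ← Cyl.twist_coface_one]
    rfl
  | zero =>
    have h := ExtScal.add_tmul (coface₀ k A (n + 1) 1) (0 : E) 0 1
    rw [add_zero, left_eq_add] at h
    simp only [map_zero, h, sub_zero]
  | add x y hx hy =>
    simp only [map_add, hx, hy, ExtScal.add_tmul]
    abel

/-- The coface map of a stratification at a level at least two is the transport of its
connection: the entry above the diagonal of `Cyl.twist` in the cocycle condition. -/
theorem Stratification.coface0_add_two (n : ℕ) (e : E) :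
    s.coface0 (n + 2) e =
      transport (cofaceAlg k A (n + 2) 1) (cofaceAlg k A (n + 2) 0) s.nabla e := by
  -- Each coface composed with `∂^0` and `∂^1`.
  have H00 : (Cyl.coface k A 1 (n + 2) 0).comp (coface₀ k A (n + 2) 0) =
    Cyl.incl k A 2 (n + 2) 2 := Cyl.coface_coface₀ k A (n + 2) 0 0
  have H01 : (Cyl.coface k A 1 (n + 2) 0).comp (coface₀ k A (n + 2) 1) =
    Cyl.incl k A 2 (n + 2) 1 := Cyl.coface_coface₀ k A (n + 2) 0 1
  have H10 : (Cyl.coface k A 1 (n + 2) 1).comp (coface₀ k A (n + 2) 0) =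
    Cyl.incl k A 2 (n + 2) 2 := Cyl.coface_coface₀ k A (n + 2) 1 0
  have H11 : (Cyl.coface k A 1 (n + 2) 1).comp (coface₀ k A (n + 2) 1) =
    Cyl.incl k A 2 (n + 2) 0 := Cyl.coface_coface₀ k A (n + 2) 1 1
  have H20 : (Cyl.coface k A 1 (n + 2) 2).comp (coface₀ k A (n + 2) 0) =
    Cyl.incl k A 2 (n + 2) 1 := Cyl.coface_coface₀ k A (n + 2) 2 0
  have H21 : (Cyl.coface k A 1 (n + 2) 2).comp (coface₀ k A (n + 2) 1) =
    Cyl.incl k A 2 (n + 2) 0 := Cyl.coface_coface₀ k A (n + 2) 2 1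
  have h : baseChange (s.θ (n + 2)).toLinearMap _ _ _ H20 H21
      (baseChange (s.θ (n + 2)).toLinearMap _ _ _ H00 H01
        (ExtScal.tmul (Cyl.incl k A 2 (n + 2) 2) e 1)) =
      baseChange (s.θ (n + 2)).toLinearMap _ _ _ H10 H11
        (ExtScal.tmul (Cyl.incl k A 2 (n + 2) 2) e 1) :=
    LinearMap.congr_fun (s.cocycle (n + 2)) (ExtScal.tmul (Cyl.incl k A 2 (n + 2) 2) e 1)
  rw [baseChange_tmul, baseChange_tmul, op_one, one_smul, one_smul] at h
  have h2 := congrArg (Bal.map (Tilde k A) LinearMap.id (Cyl.twistEntry k A (n + 1))) h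
  -- On the composite side of the cocycle condition, the factor `θ` of the copies `0` and `1` enters
  -- only through its augmentation, which is the identity.
  have h3 : ∀ x : cofaceMod k A E (n + 2) 1,
      Bal.map (Tilde k A) LinearMap.id (Cyl.twistEntry k A (n + 1))
        (baseChange (s.θ (n + 2)).toLinearMap _ _ _ H20 H21
          (ExtScal.push (coface₀ k A (n + 2) 1) (Cyl.coface k A 1 (n + 2) 0)
            (Cyl.incl k A 2 (n + 2) 1) H01 x)) =
      Bal.map (Tilde k A) LinearMap.id
        (oneForm (cofaceAlg k A (n + 2) 1) (cofaceAlg k A (n + 2) 0) ∘ₗ Cyl.degOneAt k A n) x := by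
    intro x
    induction x using ExtScal.induction_on with
    | tmul e' c =>
      rw [ExtScal.push_tmul, baseChange_tmul]
      refine (map_twistEntry_smul_push n H21 _ c).trans ?_
      have h4 := s.augMod_coface0 (n + 1) e'
      rw [Stratification.coface0_apply] at h4
      exact congrArg (fun e'' => Bal.tmul (Tilde k A) e'' _) h4
    | zero => simp only [map_zero]
    | add x y hx hy => simp only [map_add, hx, hy]
  have h5 := (h3 (s.coface0 (n + 2) e)).symm.trans
    (h2.trans (map_twistEntry_push_one (n + 1) H11 (s.coface0 (n + 2) e)))
  rw [s.augMod_coface0, ← Bal.map_comp, s.map_degOneAt_coface0] at h5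
  rw [transport_apply, h5]
  exact (add_sub_cancel _ _).symm

theorem Stratification.coface0_eq_transport (n : ℕ) (e : E) :
    s.coface0 n e = transport (cofaceAlg k A n 1) (cofaceAlg k A n 0) s.nabla e := by
  -- The levels `0` and `1` follow from level `2` by projection.
  have step : ∀ m, s.coface0 (m + 1) e = transport (cofaceAlg k A (m + 1) 1)
      (cofaceAlg k A (m + 1) 0) s.nabla e → s.coface0 m e =
      transport (cofaceAlg k A m 1) (cofaceAlg k A m 0) s.nabla e := fun m hm => by
    rw [← s.push_coface0, hm, push_proj_transport]
  exact step n (step (n + 1) (s.coface0_add_two n e))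

end Uniqueness

/-! ### The connection of a stratification is flat -/

section Flat

variable {k : Type u} [Field k]
variable {A : Type v} [NonUnitalRing A] [Module k A] [IsScalarTower k A A] [SMulCommClass k A A]
variable {E : Type w} [AddCommGroup E] [Module (Tilde k A)ᵐᵒᵖ E]

theorem Stratification.nabla_isConnection (s : Stratification k A E) :
    IsConnection k A s.nabla := by
  intro e t
  have h1 : s.coface0 2 (op t • e) = op (coface₀ k A 2 0 t) • s.coface0 2 e :=
    ExtScal.map_tmul_smul (s.θ 2).toLinearMap e t
  have h2 : s.nabla (op t • e) =
      Bal.map (Tilde k A) LinearMap.id (Cyl.degOne k A) (s.coface0 2 (op t • e)) := rfl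
  have h3 := map_oneForm_mulRight (cofaceAlg k A 2 1) (cofaceAlg k A 2 0) t (s.nabla e)
  have h4 : Bal.map (Tilde k A) LinearMap.id (Cyl.degOne k A)
      (ExtScal.tmul (coface₀ k A 2 1) e (coface₀ k A 2 0 t)) =
      Bal.tmul (Tilde k A) e (Omega1.d k A t) :=
    congrArg (Bal.tmul (Tilde k A) e) ((Cyl.degOne_coface₀ k A 0 t).trans (if_pos rfl))
  rw [h2, h1, s.coface0_eq_transport, transport_apply, smul_add, ExtScal.smul_tmul, one_mul,
    map_add]
  refine (congrArg₂ (· + ·) h4 (congrArg _ h3.symm)).trans ?_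
  rw [Bal.map_comp, degOne_comp_oneForm, Bal.map_id_id, add_comm]

theorem Stratification.θ_eq_transportHom (s : Stratification k A E) (n : ℕ) :
    (s.θ n).toLinearMap =
      transportHom (cofaceAlg k A n 1) (cofaceAlg k A n 0) s.nabla_isConnection := by
  refine ExtScal.hom_ext fun e => ?_
  refine (s.coface0_eq_transport n e).trans ?_
  refine Eq.trans ?_ (transportHom_tmul (cofaceAlg k A n 1) (cofaceAlg k A n 0) _ e 1).symm
  rw [op_one, one_smul]

/-- A stratification is determined by its connection. -/
theorem Stratification.nabla_injective :
    Function.Injective (Stratification.nabla (k := k) (A := A) (E := E)) := by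
  intro s t h
  ext n : 2
  refine LinearEquiv.toLinearMap_injective (ExtScal.hom_ext fun e => ?_)
  refine (s.coface0_eq_transport n e).trans (Eq.trans ?_ (t.coface0_eq_transport n e).symm)
  rw [h]

theorem Omega1.d_mul_d (s t : Tilde k A) :
    Omega.dA k A (s * t).snd =
      Omega.dA k A s.snd * Omega.incl k A t + Omega.incl k A s * Omega.dA k A t.snd := by
  have h : ∀ r : Tilde k A, Omega.incl k A r =
    algebraMap k _ r.fst + Omega.inA k A r.snd := fun _ => rfl
  rw [Unitization.snd_mul, map_add, map_add, Omega.dA_mul, map_smul, map_smul, h, h, mul_add,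
    add_mul, ← Algebra.commutes, ← Algebra.smul_def, ← Algebra.smul_def]
  abel

/-- The homomorphism `s ↦ s + x ds E₀₁ + y ds E₁₂`, for scalars with `x y = 0`. The last
condition removes the product `x ds · y dt E₀₂`. -/
def bidiagHom (x y : k) (h : x * y = 0) :
    Tilde k A →ₐ[k] Matrix (Fin 3) (Fin 3) (Omega k A) where
  toFun s := !![Omega.incl k A s, x • Omega.dA k A s.snd, 0;
    0, Omega.incl k A s, y • Omega.dA k A s.snd; 0, 0, Omega.incl k A s]
  map_one' := by ext i j; fin_cases i <;> fin_cases j <;> simp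
  map_mul' s t := by
    have h' : (x • Omega.dA k A s.snd) * (y • Omega.dA k A t.snd) = 0 := by
      rw [smul_mul_smul_comm, h, zero_smul]
    have h'' : ∀ z : k, z • (Omega.dA k A s.snd * Omega.incl k A t +
        Omega.incl k A s * Omega.dA k A t.snd) =
        Omega.incl k A s * (z • Omega.dA k A t.snd) +
          (z • Omega.dA k A s.snd) * Omega.incl k A t := fun z => by
      rw [smul_add, mul_smul_comm, smul_mul_assoc, add_comm]
    rw [Omega1.d_mul_d, map_mul, Matrix.mul_fin_three, h'', h'']
    simp only [zero_mul, mul_zero, add_zero, zero_add, h']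
  map_zero' := by ext i j; fin_cases i <;> fin_cases j <;> simp
  map_add' s t := by ext i j; fin_cases i <;> fin_cases j <;> simp
  commutes' r := by
    have h1 := (Omega.incl k A).commutes r
    have h2 : (algebraMap k (Tilde k A) r).snd = 0 := rfl
    rw [h1, h2, map_zero, smul_zero, smul_zero]
    ext i j
    fin_cases i <;> fin_cases j <;> simp [Matrix.algebraMap_matrix_apply]

variable (k A)

/-- The homomorphism `Q^2(A) → M₃(Ω(A))` with `a ↦ a`, `a + da E₀₁` and `a + da E₁₂` on the copies
`0`, `1` and `2`. It sends `(a¹ - a⁰) (b² - b¹)` to `da E₀₁ (db E₁₂ - db E₀₁) = da db E₀₂`. -/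
def Q.detect : Q k A 2 →ₐ[k] Matrix (Fin 3) (Fin 3) (Omega k A) :=
  Q.liftAlg k A 2 ![bidiagHom 0 0 (by simp), bidiagHom 1 0 (by simp), bidiagHom 0 1 (by simp)]

theorem Q.detect_incl_zero (s : Tilde k A) : Q.detect k A (Q.incl k A 2 0 s) =
    !![Omega.incl k A s, 0, 0; 0, Omega.incl k A s, 0; 0, 0, Omega.incl k A s] := by
  refine (Q.liftAlg_incl k A 2 _ 0 s).trans ?_
  simp [bidiagHom]

theorem Q.detect_incl_one (s : Tilde k A) : Q.detect k A (Q.incl k A 2 1 s) =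
    !![Omega.incl k A s, Omega.dA k A s.snd, 0; 0, Omega.incl k A s, 0;
      0, 0, Omega.incl k A s] := by
  refine (Q.liftAlg_incl k A 2 _ 1 s).trans ?_
  simp [bidiagHom]

theorem Q.detect_incl_two (s : Tilde k A) : Q.detect k A (Q.incl k A 2 2 s) =
    !![Omega.incl k A s, 0, 0; 0, Omega.incl k A s, Omega.dA k A s.snd;
      0, 0, Omega.incl k A s] := by
  refine (Q.liftAlg_incl k A 2 _ 2 s).trans ?_
  simp [bidiagHom]

theorem Q.detect_mem (x : Q k A 2) :
    ∃ a b c, Q.detect k A x = !![Omega.incl k A (Q.μ k A 2 x), a, b;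
      0, Omega.incl k A (Q.μ k A 2 x), c; 0, 0, Omega.incl k A (Q.μ k A 2 x)] := by
  let T : Subalgebra k (Matrix (Fin 3) (Fin 3) (Omega k A) × Tilde k A) :=
    { carrier := {z | ∃ a b c, z.1 = !![Omega.incl k A z.2, a, b;
        0, Omega.incl k A z.2, c; 0, 0, Omega.incl k A z.2]}
      mul_mem' := by
        rintro ⟨M, s⟩ ⟨N, t⟩ ⟨a, b, c, h⟩ ⟨a', b', c', h'⟩
        refine ⟨Omega.incl k A s * a' + a * Omega.incl k A t,
          Omega.incl k A s * b' + a * c' + b * Omega.incl k A t,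
          Omega.incl k A s * c' + c * Omega.incl k A t, (congrArg₂ (· * ·) h h').trans ?_⟩
        simp only [Matrix.mul_fin_three, Prod.mk_mul_mk, map_mul, zero_mul, mul_zero, add_zero,
          zero_add]
      add_mem' := by
        rintro ⟨M, s⟩ ⟨N, t⟩ ⟨a, b, c, h⟩ ⟨a', b', c', h'⟩
        refine ⟨a + a', b + b', c + c', (congrArg₂ (· + ·) h h').trans ?_⟩
        ext i j; fin_cases i <;> fin_cases j <;> simp
      algebraMap_mem' := fun r => by
        refine ⟨0, 0, 0, ?_⟩
        have h1 := (Omega.incl k A).commutes r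
        ext i j
        fin_cases i <;> fin_cases j <;> simp [Matrix.algebraMap_matrix_apply, h1] }
  refine Q.mem_of_gen k A 2 ((Q.detect k A).prod (Q.μ k A 2)) T (fun i s => ?_) x
  change ∃ a b c, Q.detect k A (Q.incl k A 2 i s) =
    !![Omega.incl k A (Q.μ k A 2 (Q.incl k A 2 i s)), a, b;
      0, Omega.incl k A (Q.μ k A 2 (Q.incl k A 2 i s)), c;
      0, 0, Omega.incl k A (Q.μ k A 2 (Q.incl k A 2 i s))]
  rw [Q.μ_incl_apply]
  fin_cases i
  · exact ⟨_, _, _, Q.detect_incl_zero k A s⟩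
  · exact ⟨_, _, _, Q.detect_incl_one k A s⟩
  · exact ⟨_, _, _, Q.detect_incl_two k A s⟩

theorem Q.detect_q_cube (x : Q k A 2) (hx : x ∈ q k A 2 ^ 3) : Q.detect k A x = 0 := by
  have h1 : ∀ y ∈ q k A 2, ∃ a b c, Q.detect k A y = !![0, a, b; 0, 0, c; 0, 0, 0] :=
    fun y hy => by
      have h := Q.detect_mem k A y
      rw [show Q.μ k A 2 y = 0 from hy, map_zero] at h
      exact h
  have h2 : ∀ y ∈ q k A 2 ^ 2, ∃ b, Q.detect k A y = !![0, 0, b; 0, 0, 0; 0, 0, 0] := by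
    intro y hy
    rw [Submodule.pow_succ, Submodule.pow_one] at hy
    refine Submodule.mul_induction_on hy (fun y hy z hz => ?_) (fun y z hy hz => ?_)
    · obtain ⟨a, b, c, h⟩ := h1 y hy
      obtain ⟨a', b', c', h'⟩ := h1 z hz
      refine ⟨a * c', ?_⟩
      rw [map_mul, h, h', Matrix.mul_fin_three]
      simp
    · obtain ⟨b, h⟩ := hy
      obtain ⟨b', h'⟩ := hz
      refine ⟨b + b', ?_⟩
      rw [map_add, h, h']
      ext i j; fin_cases i <;> fin_cases j <;> simp
  rw [Submodule.pow_succ] at hx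
  refine Submodule.mul_induction_on hx (fun y hy z hz => ?_) (fun y z hy hz => ?_)
  · obtain ⟨b, h⟩ := h2 y hy
    obtain ⟨a', b', c', h'⟩ := h1 z hz
    rw [map_mul, h, h', Matrix.mul_fin_three]
    ext i j; fin_cases i <;> fin_cases j <;> simp
  · rw [map_add, hy, hz, add_zero]

/-- `Q.detect` on `Cyl^2(A)_3`. -/
def Cyl.detect : Cyl k A 2 3 →+* Matrix (Fin 3) (Fin 3) (Omega k A) :=
  Ideal.Quotient.lift (q k A 2 ^ 3) (Q.detect k A).toRingHom (Q.detect_q_cube k A)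

theorem Cyl.detect_incl (i : Fin 3) (s : Tilde k A) :
    Cyl.detect k A (Cyl.incl k A 2 3 i s) = Q.detect k A (Q.incl k A 2 i s) := rfl

/-- The upper right entry of `Cyl.detect`, as a map of left `Ã`-modules. -/
def Cyl.detectEntry :
    Pull (Cyl.incl k A 2 3 0) →ₗ[Tilde k A] Pull (Omega.inclHom k A) where
  toFun c := Pull.of _ (Cyl.detect k A ((Pull.of _).symm c) 0 2)
  map_add' c d := congrArg (fun M : Matrix (Fin 3) (Fin 3) (Omega k A) => M 0 2)
    (map_add (Cyl.detect k A) ((Pull.of _).symm c) ((Pull.of _).symm d))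
  map_smul' s c := by
    obtain ⟨c, rfl⟩ := (Pull.of _).surjective c
    rw [Pull.smul_of, RingHom.id_apply, Pull.smul_of]
    congr 1
    simp only [AddEquiv.symm_apply_apply, map_mul, Cyl.detect_incl, Q.detect_incl_zero,
      Omega.inclHom_apply]
    simp [Matrix.mul_apply, Fin.sum_univ_three]

theorem Cyl.detectEntry_of (c : Cyl k A 2 3) :
    Cyl.detectEntry k A (Pull.of _ c) = Pull.of _ (Cyl.detect k A c 0 2) := rfl

variable {k A}

/-- `Cyl.detect` on the one-forms of the face of copies `0` and `1`. -/
theorem Cyl.detect_oneForm_zero_one (ω : Omega1 k A) :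
    Cyl.detect k A ((Pull.of _).symm
      (oneForm (Cyl.inclAlg k A 2 3 0) (Cyl.inclAlg k A 2 3 1) ω)) =
      !![0, (Pull.of _).symm ω.1, 0; 0, 0, 0; 0, 0, 0] := by
  induction ω using Omega1.induction_on with
  | gen a =>
    rw [oneForm_gen, AddEquiv.symm_apply_apply, map_sub]
    refine (congrArg₂ (· - ·) (Q.detect_incl_one k A a) (Q.detect_incl_zero k A a)).trans ?_
    ext i j; fin_cases i <;> fin_cases j <;> simp [Omega1.gen]
  | add x y ihx ihy =>
    rw [map_add, map_add, map_add, ihx, ihy]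
    ext i j; fin_cases i <;> fin_cases j <;> simp
  | smul s x ih =>
    rw [map_smul (oneForm _ _)]
    refine (map_mul (Cyl.detect k A) (Cyl.incl k A 2 3 0 s) ((Pull.of _).symm (oneForm
      (Cyl.inclAlg k A 2 3 0) (Cyl.inclAlg k A 2 3 1) x))).trans ?_
    rw [ih, Cyl.detect_incl, Q.detect_incl_zero]
    change _ = !![0, Omega.incl k A s * (Pull.of _).symm x.1, 0; 0, 0, 0; 0, 0, 0]
    ext i j; fin_cases i <;> fin_cases j <;> simp [Matrix.mul_apply, Fin.sum_univ_three]

/-- `Cyl.detect` on the one-forms of the face of copies `0` and `2`. -/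
theorem Cyl.detect_oneForm_zero_two (ω : Omega1 k A) :
    Cyl.detect k A ((Pull.of _).symm
      (oneForm (Cyl.inclAlg k A 2 3 0) (Cyl.inclAlg k A 2 3 2) ω)) =
      !![0, 0, 0; 0, 0, (Pull.of _).symm ω.1; 0, 0, 0] := by
  induction ω using Omega1.induction_on with
  | gen a =>
    rw [oneForm_gen, AddEquiv.symm_apply_apply, map_sub]
    refine (congrArg₂ (· - ·) (Q.detect_incl_two k A a) (Q.detect_incl_zero k A a)).trans ?_
    ext i j; fin_cases i <;> fin_cases j <;> simp [Omega1.gen]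
  | add x y ihx ihy =>
    rw [map_add, map_add, map_add, ihx, ihy]
    ext i j; fin_cases i <;> fin_cases j <;> simp
  | smul s x ih =>
    rw [map_smul (oneForm _ _)]
    refine (map_mul (Cyl.detect k A) (Cyl.incl k A 2 3 0 s) ((Pull.of _).symm (oneForm
      (Cyl.inclAlg k A 2 3 0) (Cyl.inclAlg k A 2 3 2) x))).trans ?_
    rw [ih, Cyl.detect_incl, Q.detect_incl_zero]
    change _ = !![0, 0, 0; 0, 0, Omega.incl k A s * (Pull.of _).symm x.1; 0, 0, 0]
    ext i j; fin_cases i <;> fin_cases j <;> simp [Matrix.mul_apply, Fin.sum_univ_three]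

/-- `Cyl.detect` on the one-forms of the face of copies `1` and `2`. -/
theorem Cyl.detect_oneForm_one_two (ω : Omega1 k A) :
    Cyl.detect k A ((Pull.of _).symm
      (oneForm (Cyl.inclAlg k A 2 3 1) (Cyl.inclAlg k A 2 3 2) ω)) =
      !![0, -(Pull.of _).symm ω.1, Omega.diff k A ((Pull.of _).symm ω.1);
        0, 0, (Pull.of _).symm ω.1; 0, 0, 0] := by
  induction ω using Omega1.induction_on with
  | gen a =>
    rw [oneForm_gen, AddEquiv.symm_apply_apply, map_sub]
    refine (congrArg₂ (· - ·) (Q.detect_incl_two k A a) (Q.detect_incl_one k A a)).trans ?_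
    ext i j; fin_cases i <;> fin_cases j <;> simp [Omega1.gen, Omega.diff_dA]
  | add x y ihx ihy =>
    rw [map_add, map_add, map_add, ihx, ihy]
    ext i j; fin_cases i <;> fin_cases j <;> simp [add_comm]
  | smul s x ih =>
    rw [map_smul (oneForm _ _)]
    refine (map_mul (Cyl.detect k A) (Cyl.incl k A 2 3 1 s) ((Pull.of _).symm (oneForm
      (Cyl.inclAlg k A 2 3 1) (Cyl.inclAlg k A 2 3 2) x))).trans ?_
    rw [ih, Cyl.detect_incl, Q.detect_incl_one]
    change _ = !![0, -(Omega.incl k A s * (Pull.of _).symm x.1),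
      Omega.diff k A (Omega.incl k A s * (Pull.of _).symm x.1);
      0, 0, Omega.incl k A s * (Pull.of _).symm x.1; 0, 0, 0]
    rw [Omega.diff_incl_mul]
    ext i j
    fin_cases i <;> fin_cases j <;> simp [Matrix.mul_apply, Fin.sum_univ_three, add_comm]

/-- `Cyl.detectEntry` inverts `formEntry` on products of two one-forms. -/
theorem Cyl.detectEntry_mul (η ω : Omega1 k A) :
    Cyl.detectEntry k A (formEntry (Cyl.inclAlg k A 2 3 0) (Cyl.inclAlg k A 2 3 1)
      (Cyl.inclAlg k A 2 3 2) 2 (Pull.of _ ((Pull.of _).symm η.1 * (Pull.of _).symm ω.1))) =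
      Pull.of _ ((Pull.of _).symm η.1 * (Pull.of _).symm ω.1) := by
  rw [formEntry_of, formsHom_mul_one]
  refine (Cyl.detectEntry_of k A _).trans ?_
  rw [map_mul, Cyl.detect_oneForm_zero_one, Cyl.detect_oneForm_one_two]
  simp [Matrix.mul_apply, Fin.sum_univ_three]

/-- `Cyl.detectEntry` inverts `formEntry` on the differentials of one-forms. -/
theorem Cyl.detectEntry_diff (ω : Omega1 k A) :
    Cyl.detectEntry k A (formEntry (Cyl.inclAlg k A 2 3 0) (Cyl.inclAlg k A 2 3 1)
      (Cyl.inclAlg k A 2 3 2) 2 (Pull.of _ (Omega.diff k A ((Pull.of _).symm ω.1)))) =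
      Pull.of _ (Omega.diff k A ((Pull.of _).symm ω.1)) := by
  have h := oneForm_add_oneForm (Cyl.inclAlg k A 2 3 0) (Cyl.inclAlg k A 2 3 1)
    (Cyl.inclAlg k A 2 3 2) ω
  rw [formEntry_of, eq_sub_of_add_eq' h.symm]
  refine (Cyl.detectEntry_of k A _).trans ?_
  rw [map_sub, map_add, Cyl.detect_oneForm_zero_one, Cyl.detect_oneForm_one_two,
    Cyl.detect_oneForm_zero_two]
  simp

variable {D : E →+ Bal (Tilde k A) E (Omega1 k A)}

/-- The curvature, as a form of degree two, is recovered from its image in `E ⊗ Cyl^2(A)_3`. -/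
theorem map_detectEntry_extend (hD : IsConnection k A D) (x : Bal (Tilde k A) E (Omega1 k A)) :
    Bal.map (Tilde k A) LinearMap.id (Cyl.detectEntry k A)
      (Bal.map (Tilde k A) LinearMap.id (formEntry (Cyl.inclAlg k A 2 3 0)
        (Cyl.inclAlg k A 2 3 1) (Cyl.inclAlg k A 2 3 2) 2) (hD.extend k A (mulForm k A 1 x))) =
      hD.extend k A (mulForm k A 1 x) := by
  induction x using Bal.induction_on with
  | tmul e ω =>
    have h1 : mulForm k A 1 (Bal.tmul (Tilde k A) e ω) =
        ExtScal.tmul (Omega.inclHom k A) e ((Pull.of _).symm ω.1) :=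
      congrArg (ExtScal.tmul (Omega.inclHom k A) e) (mul_one ((Pull.of _).symm ω.1))
    have h2 : ∀ y : Bal (Tilde k A) E (Omega1 k A),
        Bal.map (Tilde k A) LinearMap.id (Cyl.detectEntry k A)
          (Bal.map (Tilde k A) LinearMap.id (formEntry (Cyl.inclAlg k A 2 3 0)
            (Cyl.inclAlg k A 2 3 1) (Cyl.inclAlg k A 2 3 2) 2)
            (mulForm k A ((Pull.of _).symm ω.1) y)) = mulForm k A ((Pull.of _).symm ω.1) y := by
      intro y
      induction y using Bal.induction_on with
      | tmul e' η => exact congrArg (Bal.tmul (Tilde k A) e') (Cyl.detectEntry_mul η ω)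
      | zero => simp only [map_zero]
      | add x y hx hy => simp only [map_add, hx, hy]
    rw [h1, IsConnection.extend_tmul, map_add, map_add, h2]
    exact congrArg (_ + ·) (congrArg (Bal.tmul (Tilde k A) e) (Cyl.detectEntry_diff ω))
  | zero => simp only [map_zero]
  | add x y hx hy => simp only [map_add, hx, hy]

theorem Stratification.extend_nabla (s : Stratification k A E) (e : E) :
    s.nabla_isConnection.extend k A (mulForm k A 1 (s.nabla e)) = 0 := by
  -- Level `3` is the lowest at which forms of degree two survive.
  have h := s.cocycle 3
  rw [s.θ_eq_transportHom, cofaceStrat_transportHom, cofaceStrat_transportHom,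
    cofaceStrat_transportHom] at h
  have h1 := LinearMap.congr_fun h (ExtScal.tmul (Cyl.inclAlg k A 2 3 2).toRingHom e 1)
  rw [LinearMap.comp_apply, transportHom_tmul, transportHom_tmul, op_one, one_smul, one_smul,
    transport_apply, transport_apply, map_add, transportHom_tmul, op_one, one_smul,
    transport_apply, add_assoc, add_right_inj, transportHom_map_oneForm, add_eq_left] at h1
  rw [← map_detectEntry_extend, h1, map_zero]

/-- The sign rule for the differential on products with a one-form. -/
theorem Omega1.diff_mul (η : Omega1 k A) (ω : Omega k A) :
    Omega.diff k A ((Pull.of _).symm η.1 * ω) =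
      Omega.diff k A ((Pull.of _).symm η.1) * ω - (Pull.of _).symm η.1 * Omega.diff k A ω := by
  induction η using Omega1.induction_on with
  | gen a =>
    change Omega.diff k A (Omega.dA k A a * ω) =
      Omega.diff k A (Omega.dA k A a) * ω - Omega.dA k A a * Omega.diff k A ω
    rw [Omega.diff_dA, zero_mul, zero_sub]
    change Omega.diffHom k A (Omega.dA k A a * ω) 0 1 = _
    rw [map_mul, Omega.diffHom_dA, Matrix.mul_apply, Fin.sum_univ_two]
    simp [Omega.diff]
  | add x y ihx ihy =>
    have h0 : (Pull.of _).symm (x + y).1 = (Pull.of _).symm x.1 + (Pull.of _).symm y.1 := rfl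
    simp only [h0, map_add, add_mul, ihx, ihy]
    abel
  | smul s x ih =>
    change Omega.diff k A (Omega.incl k A s * (Pull.of _).symm x.1 * ω) =
      Omega.diff k A (Omega.incl k A s * (Pull.of _).symm x.1) * ω -
        Omega.incl k A s * (Pull.of _).symm x.1 * Omega.diff k A ω
    rw [mul_assoc, Omega.diff_incl_mul, Omega.diff_incl_mul, ih, mul_sub, add_mul]
    simp only [mul_assoc]
    abel

theorem Omega.diff_diff (ω : Omega k A) : Omega.diff k A (Omega.diff k A ω) = 0 := by
  -- The sign operator `ω ↦ (-1)^{|ω|} ω`, which anticommutes with `d`.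
  let γ : Omega k A → Omega k A := fun x => Omega.diffHom k A x 0 0
  have hd : ∀ x y, Omega.diff k A (x * y) = γ x * Omega.diff k A y + Omega.diff k A x * y :=
    fun x y => by
      change Omega.diffHom k A (x * y) 0 1 = _
      rw [map_mul, Matrix.mul_apply, Fin.sum_univ_two, (Omega.diffHom_lower k A y).2]
      rfl
  have hγ : ∀ x y, γ (x * y) = γ x * γ y := fun x y => by
    change Omega.diffHom k A (x * y) 0 0 = _
    rw [map_mul, Matrix.mul_apply, Fin.sum_univ_two, (Omega.diffHom_lower k A y).1, mul_zero,
      add_zero]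
  have hγa : ∀ x y, γ (x + y) = γ x + γ y := fun x y => by
    change Omega.diffHom k A (x + y) 0 0 = _
    rw [map_add]
    rfl
  let T : Subalgebra k (Omega k A) :=
    { carrier := {x | Omega.diff k A (Omega.diff k A x) = 0 ∧
        γ (Omega.diff k A x) = - Omega.diff k A (γ x)}
      mul_mem' := by
        rintro x y ⟨h1, h2⟩ ⟨h3, h4⟩
        refine ⟨?_, ?_⟩
        · rw [hd, map_add, hd, hd, h1, h2, h3]
          simp
        · rw [hd, hγa, hγ, hγ, hγ, hd, h2, h4]
          simp only [mul_neg, neg_mul]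
          abel
      add_mem' := by
        rintro x y ⟨h1, h2⟩ ⟨h3, h4⟩
        refine ⟨by rw [map_add, map_add, h1, h3, add_zero], ?_⟩
        rw [map_add, hγa, h2, h4, hγa, map_add, neg_add]
      algebraMap_mem' := fun r => by
        have h0 : Omega.diff k A (algebraMap k _ r) = 0 := by
          change Omega.diffHom k A (algebraMap k _ r) 0 1 = 0
          rw [AlgHom.commutes]
          simp [Matrix.algebraMap_matrix_apply]
        have h1 : γ (algebraMap k _ r) = algebraMap k _ r := by
          change Omega.diffHom k A (algebraMap k _ r) 0 0 = _
          rw [AlgHom.commutes]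
          simp [Matrix.algebraMap_matrix_apply]
        have h2 : γ 0 = 0 := by
          change Omega.diffHom k A 0 0 0 = 0
          rw [map_zero]
          rfl
        refine ⟨by rw [h0, map_zero], by rw [h1, h0, h2, neg_zero]⟩ }
  have hg : ∀ a, γ (Omega.dA k A a) = -Omega.dA k A a := fun a => by
    change Omega.diffHom k A (Omega.dA k A a) 0 0 = _
    rw [Omega.diffHom_dA]
    rfl
  refine (Omega.mem_of_gen k A (AlgHom.id k _) T (fun a => ?_) (fun a => ?_) ω).1
  · have h1 : Omega.diff k A (Omega.inA k A a) = Omega.dA k A a := by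
      change Omega.diffHom k A (Omega.inA k A a) 0 1 = _
      rw [Omega.diffHom_inA]
      rfl
    have h2 : γ (Omega.inA k A a) = Omega.inA k A a := by
      change Omega.diffHom k A (Omega.inA k A a) 0 0 = _
      rw [Omega.diffHom_inA]
      rfl
    change Omega.diff k A (Omega.diff k A (Omega.inA k A a)) = 0 ∧
      γ (Omega.diff k A (Omega.inA k A a)) = -Omega.diff k A (γ (Omega.inA k A a))
    rw [h2, h1, hg, Omega.diff_dA]
    exact ⟨rfl, rfl⟩
  · have h2 : γ 0 = 0 := by
      change Omega.diffHom k A 0 0 0 = 0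
      rw [map_zero]
      rfl
    change Omega.diff k A (Omega.diff k A (Omega.dA k A a)) = 0 ∧
      γ (Omega.diff k A (Omega.dA k A a)) = -Omega.diff k A (γ (Omega.dA k A a))
    rw [hg, map_neg, Omega.diff_dA, map_zero, h2, neg_zero, neg_zero]
    exact ⟨rfl, rfl⟩

theorem mulForm_mul (η ω : Omega k A) (x : Bal (Tilde k A) E (Omega1 k A)) :
    mulForm k A (η * ω) x = op ω • mulForm k A η x := by
  induction x using Bal.induction_on with
  | tmul e m =>
    exact congrArg (ExtScal.tmul (Omega.inclHom k A) e) (mul_assoc ((Pull.of _).symm m.1) η ω).symm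
  | zero => simp only [map_zero, smul_zero]
  | add x y hx hy => simp only [map_add, smul_add, hx, hy]

theorem IsConnection.extend_mulForm (hD : IsConnection k A D) (ω : Omega k A)
    (x : Bal (Tilde k A) E (Omega1 k A)) :
    hD.extend k A (mulForm k A ω x) =
      op ω • hD.extend k A (mulForm k A 1 x) - mulForm k A (Omega.diff k A ω) x := by
  induction x using Bal.induction_on with
  | tmul e η =>
    have h1 : ∀ ω, mulForm k A ω (Bal.tmul (Tilde k A) e η) =
        ExtScal.tmul (Omega.inclHom k A) e ((Pull.of _).symm η.1 * ω) := fun _ => rfl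
    rw [h1, h1, h1, mul_one, IsConnection.extend_tmul, IsConnection.extend_tmul, mulForm_mul,
      Omega1.diff_mul, smul_add, ExtScal.smul_tmul, eq_sub_iff_add_eq, add_assoc,
      ← ExtScal.tmul_add, sub_add_cancel]
  | zero => simp only [map_zero, smul_zero, sub_zero]
  | add x y hx hy =>
    simp only [map_add, smul_add, hx, hy]
    abel

/-- The curvature is determined by its values on `E`: `∇²(e ⊗ ω) = ∇²(e) ω`. -/
theorem IsConnection.isFlat_of_extend (hD : IsConnection k A D)
    (h : ∀ e, hD.extend k A (mulForm k A 1 (D e)) = 0) : IsFlatConnection k A D := by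
  refine ⟨hD, ?_⟩
  ext x
  induction x using ExtScal.induction_on with
  | tmul e ω =>
    have h0 : ExtScal.tmul (Omega.inclHom k A) e (0 : Omega k A) = 0 := Bal.tmul_zero e
    rw [AddMonoidHom.comp_apply, IsConnection.extend_tmul, map_add, hD.extend_mulForm,
      IsConnection.extend_tmul, Omega.diff_diff, h0, h, smul_zero, zero_sub, add_zero,
      neg_add_cancel]
    rfl
  | zero => simp only [map_zero]
  | add x y hx hy => rw [map_add, map_add, hx, hy]

theorem Stratification.nabla_isFlat (s : Stratification k A E) :
    IsFlatConnection k A s.nabla :=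
  s.nabla_isConnection.isFlat_of_extend s.extend_nabla

end Flat

/-! ### The isomorphism of categories -/

section Functors

variable {k : Type u} [Field k]
variable {A : Type v} [NonUnitalRing A] [Module k A] [IsScalarTower k A A] [SMulCommClass k A A]
variable {E E' : Type w} [AddCommGroup E] [Module (Tilde k A)ᵐᵒᵖ E] [AddCommGroup E']
  [Module (Tilde k A)ᵐᵒᵖ E']

theorem IsStratHom.isConnHom {s : Stratification k A E} {s' : Stratification k A E'}
    {α : E →ₗ[(Tilde k A)ᵐᵒᵖ] E'} (h : IsStratHom s s' α) : IsConnHom s.nabla s'.nabla α := by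
  intro e
  have h1 : s'.coface0 2 (α e) = ExtScal.mapLeft (coface₀ k A 2 1) α (s.coface0 2 e) :=
    h 2 (ExtScal.tmul (coface₀ k A 2 0) e 1)
  change Bal.map (Tilde k A) LinearMap.id (Cyl.degOne k A) (s'.coface0 2 (α e)) = _
  rw [h1]
  exact Bal.map_comm α (Cyl.degOne k A) (s.coface0 2 e)

theorem IsConnHom.isStratHom {s : Stratification k A E} {s' : Stratification k A E'}
    {α : E →ₗ[(Tilde k A)ᵐᵒᵖ] E'} (h : IsConnHom s.nabla s'.nabla α) : IsStratHom s s' α := by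
  intro n x
  induction x using ExtScal.induction_on with
  | tmul e c =>
    have hs := s.coface0_eq_transport n e
    have hs' := s'.coface0_eq_transport n (α e)
    have h1 := mapLeft_transport (f := cofaceAlg k A n 1) (g := cofaceAlg k A n 0) h e
    have h2 : s'.coface0 n (α e) = ExtScal.mapLeft (coface₀ k A n 1) α (s.coface0 n e) :=
      hs'.trans (h1.symm.trans (congrArg _ hs.symm))
    have h3 : ExtScal.mapLeft (coface₀ k A n 0) α (ExtScal.tmul (coface₀ k A n 0) e c) =
      ExtScal.tmul (coface₀ k A n 0) (α e) c := rfl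
    rw [h3, ExtScal.tmul_eq_smul, map_smul, ExtScal.tmul_eq_smul _ e, map_smul,
      ExtScal.mapLeft_smul]
    exact congrArg (op c • ·) h2
  | zero => simp only [map_zero]
  | add x y hx hy => simp only [map_add, hx, hy]

/-- The stratified module of a module with a flat connection. -/
def FlatMod.toStrat (X : FlatMod.{u, v, w} k A) : StratMod.{u, v, w} k A where
  carrier := X.carrier
  strat := Stratification.ofFlat X.flat.1 X.flat.2

/-- The functor `(E, ∇) ↦ (E, θ)`, `f ↦ f`. -/
def stratFunctor : FlatMod.{u, v, w} k A ⥤ StratMod.{u, v, w} k A where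
  obj X := X.toStrat
  map {X Y} f := ⟨f.hom, IsConnHom.isStratHom (by
    change IsConnHom (Stratification.ofFlat X.flat.1 X.flat.2).nabla
      (Stratification.ofFlat Y.flat.1 Y.flat.2).nabla f.hom
    rw [Stratification.ofFlat_nabla, Stratification.ofFlat_nabla]
    exact f.isConnHom)⟩

theorem StratMod.hom_heq {s t : Stratification k A E} {s' t' : Stratification k A E'}
    (hs : s = t) (hs' : s' = t') (α : E →ₗ[(Tilde k A)ᵐᵒᵖ] E') (h : IsStratHom s s' α)
    (h' : IsStratHom t t' α) :
    HEq (⟨α, h⟩ : StratMod.Hom ⟨E, s⟩ ⟨E', s'⟩) (⟨α, h'⟩ : StratMod.Hom ⟨E, t⟩ ⟨E', t'⟩) := by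
  subst hs hs'
  rfl

theorem FlatMod.hom_heq {D F : E →+ Bal (Tilde k A) E (Omega1 k A)}
    {D' F' : E' →+ Bal (Tilde k A) E' (Omega1 k A)} (hD : D = F) (hD' : D' = F')
    (d : IsFlatConnection k A D) (f : IsFlatConnection k A F) (d' : IsFlatConnection k A D')
    (f' : IsFlatConnection k A F') (α : E →ₗ[(Tilde k A)ᵐᵒᵖ] E') (h : IsConnHom D D' α)
    (h' : IsConnHom F F' α) :
    HEq (⟨α, h⟩ : FlatMod.Hom ⟨E, D, d⟩ ⟨E', D', d'⟩)
      (⟨α, h'⟩ : FlatMod.Hom ⟨E, F, f⟩ ⟨E', F', f'⟩) := by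
  subst hD hD'
  rfl

theorem isIso_connFunctor
    (hflat : ∀ X : StratMod.{u, v, w} k A, IsFlatConnection k A X.strat.nabla)
    (hhom : ∀ (X Y : StratMod.{u, v, w} k A) (f : X ⟶ Y),
      IsConnHom X.strat.nabla Y.strat.nabla f.hom) :
    IsIsoOfCategories (connFunctor hflat hhom) := by
  have h1 : ∀ X : StratMod.{u, v, w} k A,
      Stratification.ofFlat (hflat X).1 (hflat X).2 = X.strat := fun X =>
    Stratification.nabla_injective (Stratification.ofFlat_nabla _ _)
  have h2 : ∀ X : FlatMod.{u, v, w} k A,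
      (Stratification.ofFlat X.flat.1 X.flat.2).nabla = X.conn := fun X =>
    Stratification.ofFlat_nabla _ _
  refine ⟨stratFunctor, Functor.hext (fun X => ?_) (fun X Y f => ?_),
    Functor.hext (fun X => ?_) (fun X Y f => ?_)⟩
  · exact congrArg (fun s => (⟨X.carrier, s⟩ : StratMod.{u, v, w} k A)) (h1 X)
  · exact StratMod.hom_heq (h1 X) (h1 Y) f.hom _ f.isStratHom
  · obtain ⟨E, D, d⟩ := X
    change FlatMod.mk E (Stratification.ofFlat d.1 d.2).nabla _ = _
    congr 1
    exact Stratification.ofFlat_nabla _ _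
  · exact FlatMod.hom_heq (h2 X) (h2 Y) _ X.flat _ Y.flat f.hom _ f.isConnHom

end Functors

end NCStrat

end

theorem proposition2p1 (k : Type u) [Field k] (R : Type v) [NonUnitalRing R] [Module k R]
    [IsScalarTower k R R] [SMulCommClass k R R] (hR : NCStrat.IsQuasiFree k R) :
    ∃ (hflat : ∀ X : NCStrat.StratMod.{u, v, w} k R,
        NCStrat.IsFlatConnection k R X.strat.nabla)
      (hhom : ∀ (X Y : NCStrat.StratMod.{u, v, w} k R) (f : X ⟶ Y),
        NCStrat.IsConnHom X.strat.nabla Y.strat.nabla f.hom),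
      NCStrat.IsIsoOfCategories (NCStrat.connFunctor hflat hhom) :=
  ⟨fun X => X.strat.nabla_isFlat, fun _ _ f => NCStrat.IsStratHom.isConnHom f.isStratHom,
    NCStrat.isIso_connFunctor _ _⟩
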